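/- Let $d\in\mathbb N$, $d\ge 1$, $d<p\le\infty$ and $q:=\min\{p,2\}$. Let $W_p^1([0,1]^d)$ be the Sobolev space with norm $\|f\|=\bigl(\|f\|_{L_p}^p+\sum_{j=1}^d\|\partial_j f\|_{L_p}^p\bigr)^{1/p}$ (weak derivatives; maximum of the norms if $p=\infty$). Since $p>d$, each element is identified with its continuous representative on $[0,1]^d$. A method $A$ is called $(\varepsilon,\delta)$-approximating if $\mathbb P\{|A(f)-\int_{[0,1]^d}f\,dx|>\varepsilon\}\le\delta$ for all $f$ with $\|f\|\le1$, and $e(n,\delta):=e^{\mathrm{MC}}_{\mathrm{prob}}(n,\delta,W_p^1([0,1]^d))$ is the infimum of all $\varepsilon>0$ for which there is an $(\varepsilon,\delta)$-approximating randomized (possibly adaptive) algorithm that uses $n$ function values. For $m\in\mathbb N$, stratified sampling is the method $$S_m^d(f)=m^{-d}\sum_{\mathbf i\in\{0,\dots,m-1\}^d}f(\mathbf X_{\mathbf i}),$$ where the $\mathbf X_{\mathbf i}$ are independent and $\mathbf X_{\mathbf i}$ is uniformly distributed in $\prod_{j=1}^d[\tfrac{i_j}{m},\tfrac{i_j+1}{m})$.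 Put $$R(n,\delta):=n^{-1/d}\,\min\bigl\{1,\;n^{-(1-1/q)}\sqrt{\log\delta^{-1}}\bigr\}.$$ Then there are $n_0\in\mathbb N$, $\delta_0\in(0,1)$ and $c>0$, depending only on $d$ and $p$, such that for all $n\ge n_0$ and $\delta\in(0,\delta_0)$: 1. with $m:=\lfloor n^{1/d}\rfloor$, stratified sampling $S_m^d$ uses $m^d\le n$ function values and is $(c\,R(n,\delta),\delta)$-approximating; 2. consequently, $e(n,\delta)\le c\,R(n,\delta)$. If $p\ge2$, this upper bound is matched by a lower bound: there are $n_1\in\mathbb N$, $\delta_1\in(0,1)$ and $c'>0$, depending only on $d$ and $p$, with $R(n,\delta)\le c'\,e(n,\delta)$ for all $n\ge n_1$ and $\delta\in(0,\delta_1)$. -/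

import Mathlib

open MeasureTheory ProbabilityTheory Set
open scoped ENNReal

noncomputable section

namespace StratSampling

/-- The unit cube `[0,1]^d`. -/
def cube (d : ℕ) : Set (Fin d → ℝ) := Icc 0 1

/-- The integral `∫_{[0,1]^d} f(x) dx`. -/
def integralCube (d : ℕ) (f : (Fin d → ℝ) → ℝ) : ℝ := ∫ x in cube d, f x

/-! ### The Sobolev space of smoothness one on the cube -/

/-- `g = (g_1, …, g_d)` is the weak gradient of `f` on the open cube `(0,1)^d`. -/
def IsWeakGradient {d : ℕ} (f : (Fin d → ℝ) → ℝ) (g : Fin d → (Fin d → ℝ) → ℝ) : Prop :=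
  ∀ j, LocallyIntegrableOn (g j) (interior (cube d)) ∧
    ∀ φ : (Fin d → ℝ) → ℝ, ContDiff ℝ (⊤ : ℕ∞) φ → HasCompactSupport φ →
      tsupport φ ⊆ interior (cube d) →
      ∫ x in cube d, f x * fderiv ℝ φ x (Pi.single j 1) = - ∫ x in cube d, g j x * φ x

/-- The norm `(‖f‖_p^p + ∑_j ‖g_j‖_p^p)^{1/p}` (a maximum for `p = ∞`), with `L_p`-norms over the
cube; for `g` the weak gradient of `f` this is the `W_p^1`-norm of `f`. -/
def sobolevNorm {d : ℕ} (p : ℝ≥0∞) (f : (Fin d → ℝ) → ℝ) (g : Fin d → (Fin d → ℝ) → ℝ) : ℝ≥0∞ :=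
  if p = ∞ then
    max (eLpNorm f ∞ (volume.restrict (cube d)))
      (⨆ j, eLpNorm (g j) ∞ (volume.restrict (cube d)))
  else
    (eLpNorm f p (volume.restrict (cube d)) ^ p.toReal +
      ∑ j, eLpNorm (g j) p (volume.restrict (cube d)) ^ p.toReal) ^ (1 / p.toReal)

/-- The space `W_p^1([0,1]^d)` for `p > d`, whose elements are represented by their continuous
representatives, so that function values make sense. Values outside the cube are irrelevant. -/
def sobolevSpace (d : ℕ) (p : ℝ≥0∞) : Set ((Fin d → ℝ) → ℝ) :=
  {f | ContinuousOn f (cube d) ∧ ∃ g, IsWeakGradient f g ∧ sobolevNorm p f g < ∞}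

/-- The closed unit ball of `W_p^1([0,1]^d)`. The weak gradient is unique up to null sets, hence
the choice of `g` does not matter. -/
def sobolevBall (d : ℕ) (p : ℝ≥0∞) : Set ((Fin d → ℝ) → ℝ) :=
  {f | ContinuousOn f (cube d) ∧ ∃ g, IsWeakGradient f g ∧ sobolevNorm p f g ≤ 1}

/-! ### Monte Carlo algorithms and the probabilistic error -/

/-- The list of the first `k` function values of `f`, when the next sample point is `node y` with
`y` the list of the function values obtained so far. -/
def collect {d : ℕ} (node : List ℝ → cube d) (f : (Fin d → ℝ) → ℝ) : ℕ → List ℝ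
  | 0 => []
  | k + 1 => collect node f k ++ [f (node (collect node f k))]

/-- A (possibly adaptive) Monte Carlo algorithm using `n` function values, for integrands from the
class `W`: for each `ω` it collects `n` function values at the points determined by `node ω`, and
returns `output ω` of the list of these values. -/
structure MCAlgorithm (d n : ℕ) (W : Set ((Fin d → ℝ) → ℝ)) where
  Ω : Type
  [mΩ : MeasurableSpace Ω]
  P : Measure Ω
  [isProb : IsProbabilityMeasure P]
  node : Ω → List ℝ → cube d
  output : Ω → List ℝ → ℝ
  measurable_error : ∀ f ∈ W,
    Measurable fun ω => |output ω (collect (node ω) f n) - integralCube d f|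

attribute [instance] MCAlgorithm.mΩ MCAlgorithm.isProb

/-- The output of a Monte Carlo algorithm for the realization `ω` and the input `f`. -/
def MCAlgorithm.run {d n : ℕ} {W : Set ((Fin d → ℝ) → ℝ)} (A : MCAlgorithm d n W) (ω : A.Ω)
    (f : (Fin d → ℝ) → ℝ) : ℝ :=
  A.output ω (collect (A.node ω) f n)

/-- A randomized method `A` on the probability space `(Ω, P)` is `(ε,δ)`-approximating for the
inputs `f ∈ B`. -/
def IsApproximating {d : ℕ} {Ω : Type*} [MeasurableSpace Ω] (P : Measure Ω)
    (A : Ω → ((Fin d → ℝ) → ℝ) → ℝ) (B : Set ((Fin d → ℝ) → ℝ)) (ε δ : ℝ) : Prop :=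
  ∀ f ∈ B, P {ω | ε < |A ω f - integralCube d f|} ≤ ENNReal.ofReal δ

/-- The `n`-th minimal probabilistic Monte Carlo error at uncertainty `δ` on `W_p^1([0,1]^d)`: the
infimum of all `ε > 0` such that some `(ε,δ)`-approximating algorithm uses `n` function values. -/
def eProb (d : ℕ) (p : ℝ≥0∞) (n : ℕ) (δ : ℝ) : ℝ≥0∞ :=
  ⨅ (ε : ℝ) (_ : 0 < ε ∧ ∃ A : MCAlgorithm d n (sobolevSpace d p),
    IsApproximating A.P A.run (sobolevBall d p) ε δ), ENNReal.ofReal ε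

/-! ### Stratified sampling -/

/-- The subcube `∏_j [i_j/m, (i_j+1)/m)`. -/
def subcube {d m : ℕ} (i : Fin d → Fin m) : Set (Fin d → ℝ) :=
  {x | ∀ j, ((i j : ℕ) : ℝ) / m ≤ x j ∧ x j < (((i j : ℕ) : ℝ) + 1) / m}

/-- The random points `X_i` are independent, each uniformly distributed in its subcube. -/
def IsStratifiedSample {d m : ℕ} {Ω : Type*} [MeasurableSpace Ω] (P : Measure Ω)
    (X : (Fin d → Fin m) → Ω → (Fin d → ℝ)) : Prop :=
  (∀ i, Measurable (X i)) ∧ iIndepFun X P ∧ ∀ i, pdf.IsUniform (X i) (subcube i) P volume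

/-- Stratified sampling `S_m^d(f) = m^{-d} ∑_i f(X_i)`. -/
def stratified {d m : ℕ} {Ω : Type*} (X : (Fin d → Fin m) → Ω → (Fin d → ℝ)) (ω : Ω)
    (f : (Fin d → ℝ) → ℝ) : ℝ :=
  1 / (m : ℝ) ^ d * ∑ i, f (X i ω)

/-- The number `m = ⌊n^{1/d}⌋` of subdivisions per coordinate for the information budget `n`. -/
def gridSize (d n : ℕ) : ℕ := ⌊(n : ℝ) ^ (1 / (d : ℝ))⌋₊

/-! ### Rates -/

/-- `n^{-1/d} min{1, n^{-(1-1/q)} √(log δ⁻¹)}` -/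
def rate (d : ℕ) (q : ℝ) (n : ℕ) (δ : ℝ) : ℝ :=
  (n : ℝ) ^ (-(1 / (d : ℝ))) * min 1 ((n : ℝ) ^ (-(1 - 1 / q)) * √(Real.log δ⁻¹))

/-- `Q c n δ` holds for some constant `c > 0`, all large `n` and all small `δ > 0`. -/
def ForSomeConstEventually (Q : ℝ → ℕ → ℝ → Prop) : Prop :=
  ∃ n₀ : ℕ, ∃ δ₀ ∈ Ioo (0 : ℝ) 1, ∃ c : ℝ, 0 < c ∧
    ∀ n : ℕ, n₀ ≤ n → ∀ δ ∈ Ioo (0 : ℝ) δ₀, Q c n δ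

/-- The relation `e(n,δ) ⪯ f(n,δ)`. -/
def AsympLE (e f : ℕ → ℝ → ℝ≥0∞) : Prop :=
  ForSomeConstEventually fun c n δ => e n δ ≤ ENNReal.ofReal c * f n δ

end StratSampling
end

namespace StratSampling

/-! Upper bound. A Morrey inequality on each subcube (`abs_sub_weightedMean_le`) confines `f` to an
interval of radius `a i` there, where `a i` is a multiple of `m^{-(1-d/p)}` times the sum of the
local `L_p`-norms of the weak partial derivatives. Since `p`-th powers of these norms add up over
the partition, `∑ a i ^ p ≤ (A/m)^p m^d` (`exists_deviation_bound`). The error of stratified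
sampling is a normalized sum of independent centred variables, the `i`-th with values in an interval
of length `2 * a i`. The `ℓ_1`-norm of `a` bounds the error almost surely and gives the `1` in the
minimum; the `ℓ_2`-norm of `a` enters Hoeffding's inequality and gives the term with `√(log δ⁻¹)`.
Passing from `ℓ_p` to `ℓ_2` is what produces `q = min p 2`.

The Morrey inequality is proved directly from the definition of the weak gradient. A bump `φ` spread
over the subcube is contracted towards `x`; its density obeys a continuity equation whose flux is an
admissible test function, so the averages of `f` have a derivative controlled by the weak gradient,
integrable in the contraction parameter because `d < p`.

Lower bound. Put bumps with random signs on `k^d ≥ 2n` disjoint subcubes. A run with `n` function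
values meets at most `n` of them, and the other signs remain uniform given what was seen
(`le_card_filter_of_forall_piecewise`). Their sum is large with probability more than `δ` by
Paley–Zygmund applied to its exponential (`card_lt_sum_sgn_ge`). Averaging over the signs for each
fixed `ω` and then over `ω` yields an input on which the algorithm fails (`lt_of_isApproximating`).
This bound has the form of `rate` with `q = 2`, hence it matches for `p ≥ 2`. -/

/-! ### Elementary facts about the cube, and a bump function -/

lemma mem_cube {d : ℕ} {x : Fin d → ℝ} : x ∈ cube d ↔ ∀ j, 0 ≤ x j ∧ x j ≤ 1 := by
  simp only [cube, mem_Icc, Pi.le_def, Pi.zero_apply, Pi.one_apply, forall_and]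

lemma mem_interior_cube {d : ℕ} {x : Fin d → ℝ} :
    x ∈ interior (cube d) ↔ ∀ j, 0 < x j ∧ x j < 1 := by
  rw [cube, ← pi_univ_Icc, interior_pi_set finite_univ]
  simp

lemma isCompact_cube (d : ℕ) : IsCompact (cube d) := isCompact_Icc

lemma measurableSet_cube (d : ℕ) : MeasurableSet (cube d) := measurableSet_Icc

lemma volume_cube (d : ℕ) : volume (cube d) = 1 := by
  simp [cube, Real.volume_Icc_pi]

instance isProbabilityMeasure_restrict_cube (d : ℕ) :
    IsProbabilityMeasure (volume.restrict (cube d)) :=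
  ⟨by simp [volume_cube]⟩

lemma volume_restrict_interior_cube (d : ℕ) :
    volume.restrict (interior (cube d)) = volume.restrict (cube d) := by
  refine Measure.restrict_congr_set (interior_ae_eq_of_null_frontier ?_)
  exact (convex_Icc (0 : Fin d → ℝ) 1).addHaar_frontier volume

lemma IsWeakGradient.aestronglyMeasurable {d : ℕ} {f : (Fin d → ℝ) → ℝ}
    {g : Fin d → (Fin d → ℝ) → ℝ} (hg : IsWeakGradient f g) (j : Fin d) :
    AEStronglyMeasurable (g j) (volume.restrict (cube d)) := by
  rw [← volume_restrict_interior_cube]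
  exact (hg j).1.aestronglyMeasurable

/-- A smooth bump function supported in the open unit cube. -/
lemma exists_bump (d : ℕ) : ∃ φ : (Fin d → ℝ) → ℝ, ContDiff ℝ (⊤ : ℕ∞) φ ∧ HasCompactSupport φ ∧
    tsupport φ ⊆ interior (cube d) ∧ (∀ x, 0 ≤ φ x) ∧ (∀ x, φ x ≤ 1) ∧ 0 < ∫ x, φ x := by
  have hx : interior (cube d) ∈ nhds (fun _ : Fin d => (1 / 2 : ℝ)) :=
    isOpen_interior.mem_nhds (mem_interior_cube.2 fun j => by norm_num)
  obtain ⟨φ, h1, h2, h3, h4, h5⟩ := exists_contDiff_tsupport_subset (n := ⊤) hx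
  have h6 : ∀ x, φ x ∈ Icc (0 : ℝ) 1 := fun x => h4 ⟨x, rfl⟩
  refine ⟨φ, h3, h2, h1, fun x => (h6 x).1, fun x => (h6 x).2, ?_⟩
  exact h3.continuous.integral_pos_of_hasCompactSupport_nonneg_nonzero h2 (fun x => (h6 x).1)
    (x := fun _ => (1 / 2 : ℝ)) (by rw [h5]; exact one_ne_zero)

/-! ### A Morrey inequality on cubes -/

section Morrey

variable {d : ℕ}

/-- The inverse of the map `u ↦ x + s • (a + h • u - x)`. -/
noncomputable def shrinkInv (x a : Fin d → ℝ) (h s : ℝ) (y : Fin d → ℝ) : Fin d → ℝ :=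
  h⁻¹ • (s⁻¹ • (y - x) - (a - x))

/-- The density of the push-forward of `φ` under `u ↦ x + s • (a + h • u - x)`. -/
noncomputable def shrinkDensity (φ : (Fin d → ℝ) → ℝ) (x a : Fin d → ℝ) (h s : ℝ) (y : Fin d → ℝ) : ℝ :=
  (s * h)⁻¹ ^ d * φ (shrinkInv x a h s y)

/-- The flux of mass when the parameter `s` of `shrinkDensity` varies. -/
noncomputable def shrinkFlux (φ : (Fin d → ℝ) → ℝ) (x a : Fin d → ℝ) (h s : ℝ) (j : Fin d) (y : Fin d → ℝ) : ℝ :=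
  ((y j - x j) * s⁻¹) * shrinkDensity φ x a h s y

lemma shrinkInv_apply (x a : Fin d → ℝ) {h s : ℝ} (hh : h ≠ 0) (hs : s ≠ 0) (y : Fin d → ℝ)
    (j : Fin d) : y j = x j + s * (a j + h * shrinkInv x a h s y j - x j) := by
  simp only [shrinkInv, Pi.smul_apply, Pi.sub_apply, smul_eq_mul]
  field_simp
  ring

lemma contDiff_shrinkInv (x a : Fin d → ℝ) (h s : ℝ) {n : WithTop ℕ∞} :
    ContDiff ℝ n (shrinkInv x a h s) := by
  unfold shrinkInv
  fun_prop

lemma hasFDerivAt_shrinkInv (x a : Fin d → ℝ) (h s : ℝ) (y : Fin d → ℝ) :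
    HasFDerivAt (shrinkInv x a h s) (h⁻¹ • s⁻¹ • ContinuousLinearMap.id ℝ (Fin d → ℝ)) y :=
  ((((hasFDerivAt_id y).sub_const x).const_smul s⁻¹).sub_const (a - x)).const_smul h⁻¹

lemma hasDerivAt_shrinkDensity {φ : (Fin d → ℝ) → ℝ} (hφ : Differentiable ℝ φ)
    (x a y : Fin d → ℝ) {h s : ℝ} (hh : h ≠ 0) (hs : s ≠ 0) :
    HasDerivAt (fun s => shrinkDensity φ x a h s y)
      (-(s⁻¹ * (s * h)⁻¹ ^ d * (d * φ (shrinkInv x a h s y) +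
        fderiv ℝ φ (shrinkInv x a h s y) ((h⁻¹ * s⁻¹) • (y - x))))) s := by
  have h1 : HasDerivAt (fun s => shrinkInv x a h s y) (h⁻¹ • ((-(s ^ 2)⁻¹) • (y - x))) s :=
    (((hasDerivAt_inv hs).smul_const (y - x)).sub_const (a - x)).const_smul h⁻¹
  have h2 := (hφ (shrinkInv x a h s y)).hasFDerivAt.comp_hasDerivAt s h1
  have h3 : HasDerivAt (fun s : ℝ => (s * h)⁻¹ ^ d) (-(d * s⁻¹ * (s * h)⁻¹ ^ d)) s := by
    have h4 := (((hasDerivAt_id s).mul_const h).inv (mul_ne_zero hs hh)).pow d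
    refine h4.congr_deriv ?_
    -- The power rule carries the truncated exponent `d - 1`, so `d = 0` is separate.
    rcases d with _ | d
    · simp
    · simp only [id, Nat.add_sub_cancel, pow_succ]
      rw [Pi.inv_apply]
      field_simp
  refine (h3.mul h2).congr_deriv ?_
  simp only [map_smul, smul_eq_mul, Function.comp]
  field_simp
  ring

lemma contDiff_shrinkFlux {φ : (Fin d → ℝ) → ℝ} {n : WithTop ℕ∞} (hφ : ContDiff ℝ n φ)
    (x a : Fin d → ℝ) (h s : ℝ) (j : Fin d) : ContDiff ℝ n (shrinkFlux φ x a h s j) := by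
  have := contDiff_shrinkInv x a h s (n := n)
  unfold shrinkFlux shrinkDensity
  fun_prop

lemma fderiv_shrinkFlux {φ : (Fin d → ℝ) → ℝ} (hφ : Differentiable ℝ φ)
    (x a y : Fin d → ℝ) (h s : ℝ) (j : Fin d) :
    fderiv ℝ (shrinkFlux φ x a h s j) y (Pi.single j 1) =
      s⁻¹ * (s * h)⁻¹ ^ d * (φ (shrinkInv x a h s y) +
        fderiv ℝ φ (shrinkInv x a h s y) ((h⁻¹ * s⁻¹) • (y j - x j) • Pi.single j 1)) := by
  have h1 := (hφ (shrinkInv x a h s y)).hasFDerivAt.comp y (hasFDerivAt_shrinkInv x a h s y)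
  have h2 : HasFDerivAt (fun y : Fin d → ℝ => (y j - x j) * s⁻¹)
      (s⁻¹ • ContinuousLinearMap.proj (R := ℝ) (φ := fun _ : Fin d => ℝ) j) y :=
    (((ContinuousLinearMap.proj (R := ℝ) (φ := fun _ : Fin d => ℝ) j).hasFDerivAt).sub_const
      (x j)).mul_const s⁻¹
  have h3 := h2.mul (h1.const_mul ((s * h)⁻¹ ^ d))
  have h4 : fderiv ℝ (shrinkFlux φ x a h s j) y = _ := h3.fderiv
  rw [h4]
  simp only [add_apply, FunLike.coe_smul, Pi.smul_apply,
    ContinuousLinearMap.proj_apply, ContinuousLinearMap.comp_apply, ContinuousLinearMap.id_apply,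
    smul_eq_mul, Pi.single_eq_same, map_smul, Function.comp]
  ring

/-- Continuity equation: mass moves along rays from `x` with velocity `(y - x) / s`, so this
divergence is minus the `s`-derivative found in `hasDerivAt_shrinkDensity`. The term with `d` is the
divergence of `y - x`. -/
lemma sum_fderiv_shrinkFlux {φ : (Fin d → ℝ) → ℝ} (hφ : Differentiable ℝ φ)
    (x a y : Fin d → ℝ) (h s : ℝ) :
    ∑ j, fderiv ℝ (shrinkFlux φ x a h s j) y (Pi.single j 1) =
      s⁻¹ * (s * h)⁻¹ ^ d * (d * φ (shrinkInv x a h s y) +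
        fderiv ℝ φ (shrinkInv x a h s y) ((h⁻¹ * s⁻¹) • (y - x))) := by
  simp_rw [fderiv_shrinkFlux hφ]
  rw [← Finset.mul_sum, Finset.sum_add_distrib, ← map_sum, ← Finset.smul_sum]
  have : ∑ j, (y j - x j) • (Pi.single j 1 : Fin d → ℝ) = y - x := by
    ext i
    simp [Finset.sum_apply, Pi.single_apply]
  rw [this]
  simp

/-- Convexity: `y` is a convex combination of a point of the closed cube and an interior point, the
latter with weight `s > 0`. It keeps the support of the flux inside the open cube, as test functions
require. -/
lemma mem_interior_cube_of_shrinkInv_mem {x a y : Fin d → ℝ} {h s : ℝ} (hh : 0 < h)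
    (hs : s ∈ Ioo (0 : ℝ) 1) (ha : ∀ j, 0 ≤ a j ∧ a j + h ≤ 1) (hx : x ∈ cube d)
    (hy : shrinkInv x a h s y ∈ interior (cube d)) : y ∈ interior (cube d) := by
  rw [mem_interior_cube] at hy ⊢
  intro i
  rw [mem_cube] at hx
  obtain ⟨h3, h4⟩ := hy i
  obtain ⟨h5, h6⟩ := hx i
  obtain ⟨h7, h8⟩ := ha i
  have h9 : 0 < a i + h * shrinkInv x a h s y i := by positivity
  have h10 : a i + h * shrinkInv x a h s y i < 1 := by nlinarith
  rw [shrinkInv_apply x a hh.ne' hs.1.ne' y i]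
  set t := a i + h * shrinkInv x a h s y i
  have := hs.1
  have := hs.2
  constructor <;> nlinarith

lemma tsupport_shrinkFlux_subset {φ : (Fin d → ℝ) → ℝ} (hφ : tsupport φ ⊆ interior (cube d))
    {x a : Fin d → ℝ} {h s : ℝ} (hh : 0 < h) (hs : s ∈ Ioo (0 : ℝ) 1)
    (ha : ∀ j, 0 ≤ a j ∧ a j + h ≤ 1) (hx : x ∈ cube d) (j : Fin d) :
    tsupport (shrinkFlux φ x a h s j) ⊆ interior (cube d) := by
  intro y hy
  have h1 : y ∈ tsupport (φ ∘ shrinkInv x a h s) :=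
    tsupport_mul_subset_right (tsupport_mul_subset_right hy)
  exact mem_interior_cube_of_shrinkInv_mem hh hs ha hx
    (hφ (tsupport_comp_subset_preimage φ (contDiff_shrinkInv x a h s (n := 0)).continuous h1))

lemma continuousOn_shrink_deriv {φ : (Fin d → ℝ) → ℝ} (hφ : ContDiff ℝ 1 φ) (x a : Fin d → ℝ)
    {h : ℝ} (hh : 0 < h) :
    ContinuousOn (fun z : ℝ × (Fin d → ℝ) =>
      -(z.1⁻¹ * (z.1 * h)⁻¹ ^ d * (d * φ (shrinkInv x a h z.1 z.2) +
        fderiv ℝ φ (shrinkInv x a h z.1 z.2) ((h⁻¹ * z.1⁻¹) • (z.2 - x)))))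
      {z | z.1 ≠ 0} := by
  have h1 : ContinuousOn (fun z : ℝ × (Fin d → ℝ) => z.1⁻¹) {z | z.1 ≠ 0} :=
    continuousOn_fst.inv₀ fun z hz => hz
  have h1' : ContinuousOn (fun z : ℝ × (Fin d → ℝ) => (z.1 * h)⁻¹) {z | z.1 ≠ 0} :=
    (continuousOn_fst.mul continuousOn_const).inv₀ fun z hz => mul_ne_zero hz hh.ne'
  have h2 : ContinuousOn (fun z : ℝ × (Fin d → ℝ) => shrinkInv x a h z.1 z.2) {z | z.1 ≠ 0} := by
    unfold shrinkInv
    exact ((h1.smul (continuousOn_snd.sub continuousOn_const)).sub continuousOn_const).const_smul h⁻¹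
  have h3 : ContinuousOn (fun z : ℝ × (Fin d → ℝ) => φ (shrinkInv x a h z.1 z.2)) {z | z.1 ≠ 0} :=
    hφ.continuous.comp_continuousOn h2
  have h4 : ContinuousOn (fun z : ℝ × (Fin d → ℝ) => fderiv ℝ φ (shrinkInv x a h z.1 z.2))
      {z | z.1 ≠ 0} := (hφ.continuous_fderiv one_ne_zero).comp_continuousOn h2
  have h5 : ContinuousOn (fun z : ℝ × (Fin d → ℝ) => (h⁻¹ * z.1⁻¹) • (z.2 - x)) {z | z.1 ≠ 0} :=
    (continuousOn_const.mul h1).smul (by fun_prop)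
  exact ((h1.mul (h1'.pow d)).mul ((continuousOn_const.mul h3).add (h4.clm_apply h5))).neg

lemma continuous_shrinkDensity {φ : (Fin d → ℝ) → ℝ} (hφ : Continuous φ)
    (x a : Fin d → ℝ) (h s : ℝ) : Continuous (shrinkDensity φ x a h s) := by
  have := (contDiff_shrinkInv x a h s (n := 0)).continuous
  unfold shrinkDensity
  fun_prop

/-- After the change of variables, `s` occurs only in the smooth density, so no derivative of `f` is
needed to differentiate under the integral. The continuity equation then turns the integrand into
`f` times a divergence, and the weak gradient is tested against the flux. -/
lemma hasDerivAt_integral_shrinkDensity {φ f : (Fin d → ℝ) → ℝ}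
    {g : Fin d → (Fin d → ℝ) → ℝ} (hf : Continuous f) (hg : IsWeakGradient f g)
    (hφ : ContDiff ℝ (⊤ : ℕ∞) φ) (hφs : tsupport φ ⊆ interior (cube d))
    {x a : Fin d → ℝ} {h s : ℝ} (hh : 0 < h) (hs : s ∈ Ioo (0 : ℝ) 1)
    (ha : ∀ j, 0 ≤ a j ∧ a j + h ≤ 1) (hx : x ∈ cube d) :
    HasDerivAt (fun s => ∫ y in cube d, f y * shrinkDensity φ x a h s y)
      (∑ j, ∫ y in cube d, g j y * shrinkFlux φ x a h s j y) s := by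
  have hs0 := hs.1
  have hdiff : Differentiable ℝ φ := hφ.differentiable (by simp)
  set D : ℝ → (Fin d → ℝ) → ℝ := fun s y => -(s⁻¹ * (s * h)⁻¹ ^ d *
    (d * φ (shrinkInv x a h s y) + fderiv ℝ φ (shrinkInv x a h s y) ((h⁻¹ * s⁻¹) • (y - x)))) with hD
  have hDc : ContinuousOn (fun z : ℝ × (Fin d → ℝ) => f z.2 * D z.1 z.2) {z | z.1 ≠ 0} :=
    (hf.comp continuous_snd).continuousOn.mul
      (continuousOn_shrink_deriv (hφ.of_le (by exact_mod_cast le_top)) x a hh)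
  -- Cutting off at `s / 2` keeps the parameter away from the singularity at `0`, so compactness
  -- gives a dominating constant.
  obtain ⟨C, hC⟩ := (isCompact_Icc (a := s / 2) (b := 1)).prod (isCompact_cube d)
    |>.exists_bound_of_continuousOn (f := fun z : ℝ × (Fin d → ℝ) => f z.2 * D z.1 z.2)
      (hDc.mono fun z hz => ((half_pos hs0).trans_le hz.1.1).ne')
  have hDs : Continuous (fun y => f y * D s y) := by
    rw [← continuousOn_univ]
    exact hDc.comp (f := fun y => (s, y)) (by fun_prop) (fun y _ => hs0.ne')
  have key := (hasDerivAt_integral_of_dominated_loc_of_deriv_le (𝕜 := ℝ)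
    (μ := volume.restrict (cube d)) (F := fun s y => f y * shrinkDensity φ x a h s y)
    (F' := fun s y => f y * D s y) (x₀ := s) (s := Ioo (s / 2) 1) (bound := fun _ => C)
    (Ioo_mem_nhds (by linarith) hs.2)
    (Filter.Eventually.of_forall fun t =>
      (hf.mul (continuous_shrinkDensity hφ.continuous x a h t)).aestronglyMeasurable)
    ((hf.mul (continuous_shrinkDensity hφ.continuous x a h s)).continuousOn.integrableOn_compact
      (isCompact_cube d))
    hDs.aestronglyMeasurable
    (by
      filter_upwards [ae_restrict_mem (measurableSet_cube d)] with y hy t ht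
      exact hC (t, y) ⟨⟨ht.1.le, ht.2.le⟩, hy⟩)
    (integrable_const C)
    (Filter.Eventually.of_forall fun y t ht =>
      (hasDerivAt_shrinkDensity hdiff x a y hh.ne' (by linarith [ht.1] : 0 < t).ne').const_mul
        (f y))).2
  refine key.congr_deriv ?_
  have hsupp := fun j => tsupport_shrinkFlux_subset hφs hh hs ha hx j
  have hcomp : ∀ j, HasCompactSupport (shrinkFlux φ x a h s j) := fun j =>
    (isCompact_cube d).of_isClosed_subset (isClosed_tsupport _)
      ((hsupp j).trans interior_subset)
  have hw := fun j => (hg j).2 _ (contDiff_shrinkFlux hφ x a h s j) (hcomp j) (hsupp j)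
  have hsum : ∀ y, f y * D s y =
      -∑ j, f y * fderiv ℝ (shrinkFlux φ x a h s j) y (Pi.single j 1) := by
    intro y
    rw [← Finset.mul_sum, sum_fderiv_shrinkFlux hdiff, hD]
    ring
  simp_rw [hsum]
  rw [integral_neg, integral_finsetSum]
  · simp_rw [hw]
    simp
  · intro j _
    have h1 : Continuous (fun y => fderiv ℝ (shrinkFlux φ x a h s j) y (Pi.single j 1)) :=
      ((contDiff_shrinkFlux hφ x a h s j).continuous_fderiv (by simp)).clm_apply continuous_const
    exact (hf.mul h1).continuousOn.integrableOn_compact (isCompact_cube d)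

/-- The velocity is at most `h`, the density at most `(s * h)^{-d}`, and the flux lives on a cube of
volume `(s * h)^d`; Hölder on that cube contributes `(s * h)^{d (1 - 1/p)}`. -/
lemma enorm_integral_mul_shrinkFlux_le {φ g : (Fin d → ℝ) → ℝ}
    (hg : AEStronglyMeasurable g (volume.restrict (cube d)))
    (hφs : tsupport φ ⊆ interior (cube d)) (hφ0 : ∀ x, 0 ≤ φ x) (hφ1 : ∀ x, φ x ≤ 1)
    {p : ℝ} (hp : 1 ≤ p)
    {x a : Fin d → ℝ} {h s : ℝ} (hh : 0 < h) (hs : s ∈ Ioo (0 : ℝ) 1)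
    (ha : ∀ j, 0 ≤ a j ∧ a j + h ≤ 1) (hx : x ∈ Icc a (fun j => a j + h)) (j : Fin d) :
    ‖∫ y in cube d, g y * shrinkFlux φ x a h s j y‖ₑ ≤
      ENNReal.ofReal (h * (s * h) ^ (-(d / p))) *
        eLpNorm g (ENNReal.ofReal p) (volume.restrict (Icc a (fun j => a j + h))) := by
  obtain ⟨hs0, hs1⟩ := hs
  have hsh : 0 < s * h := mul_pos hs0 hh
  -- `T` is the image of the subcube under the homothety with centre `x` and ratio `s`; it stays in
  -- the subcube because `x` belongs to it.
  set b : Fin d → ℝ := fun i => x i + s * (a i - x i) with hb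
  set T : Set (Fin d → ℝ) := Icc b (fun i => b i + s * h) with hT
  have hTQ : T ⊆ Icc a (fun j => a j + h) := by
    intro y hy
    refine ⟨fun i => ?_, fun i => ?_⟩
    · have h1 := hy.1 i
      have h2 := hx.1 i
      simp only [hb] at h1
      nlinarith
    · have h1 := hy.2 i
      have h2 : x i ≤ a i + h := hx.2 i
      simp only [hb] at h1
      show y i ≤ a i + h
      nlinarith
  have hQ : Icc a (fun j => a j + h) ⊆ cube d := by
    intro y hy
    exact mem_cube.2 fun i => ⟨(ha i).1.trans (hy.1 i), (hy.2 i).trans (ha i).2⟩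
  have hTm : MeasurableSet T := measurableSet_Icc
  have hflux : ∀ y, ‖g y * shrinkFlux φ x a h s j y‖ₑ ≤
      T.indicator (fun y => ENNReal.ofReal (h * (s * h)⁻¹ ^ d) * ‖g y‖ₑ) y := by
    intro y
    by_cases hy : φ (shrinkInv x a h s y) = 0
    · simp [shrinkFlux, shrinkDensity, hy]
    · have h1 := mem_interior_cube.1 (hφs (subset_tsupport φ hy))
      have h2 := fun i => shrinkInv_apply x a hh.ne' hs0.ne' y i
      have hyT : y ∈ T := by
        refine ⟨fun i => ?_, fun i => ?_⟩
        · rw [h2 i]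
          have := mul_pos hsh (h1 i).1
          simp only [hb]
          nlinarith
        · have := mul_lt_mul_of_pos_left (h1 i).2 hsh
          have h3 := h2 i
          simp only [hb]
          nlinarith
      rw [indicator_of_mem hyT, enorm_mul, mul_comm]
      gcongr
      rw [Real.enorm_eq_ofReal_abs]
      apply ENNReal.ofReal_le_ofReal
      have h4 : |(y j - x j) * s⁻¹| ≤ h := by
        have h5 : (y j - x j) * s⁻¹ = a j + h * shrinkInv x a h s y j - x j := by
          have := h2 j
          field_simp
          linarith
        rw [h5, abs_le]
        have h6 := hx.1 j
        have h7 : x j ≤ a j + h := hx.2 j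
        obtain ⟨h8, h9⟩ := h1 j
        constructor <;> nlinarith
      unfold shrinkFlux shrinkDensity
      rw [abs_mul, abs_mul ((s * h)⁻¹ ^ d), abs_of_nonneg (hφ0 _), abs_of_pos (by positivity : 0 < (s * h)⁻¹ ^ d)]
      have := hφ1 (shrinkInv x a h s y)
      have := hφ0 (shrinkInv x a h s y)
      calc |(y j - x j) * s⁻¹| * ((s * h)⁻¹ ^ d * φ (shrinkInv x a h s y))
          ≤ h * ((s * h)⁻¹ ^ d * 1) := by gcongr
        _ = _ := by ring
  have hvol : volume T = ENNReal.ofReal ((s * h) ^ d) := by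
    rw [hT, Real.volume_Icc_pi]
    simp [ENNReal.ofReal_pow hsh.le]
  calc ‖∫ y in cube d, g y * shrinkFlux φ x a h s j y‖ₑ
      ≤ ∫⁻ y in cube d, ‖g y * shrinkFlux φ x a h s j y‖ₑ := enorm_integral_le_lintegral_enorm _
    _ ≤ ∫⁻ y in cube d, T.indicator (fun y => ENNReal.ofReal (h * (s * h)⁻¹ ^ d) * ‖g y‖ₑ) y :=
        lintegral_mono hflux
    _ = ∫⁻ y in T, ENNReal.ofReal (h * (s * h)⁻¹ ^ d) * ‖g y‖ₑ := by
        rw [lintegral_indicator hTm, Measure.restrict_restrict hTm,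
          inter_eq_self_of_subset_left (hTQ.trans hQ)]
    _ = ENNReal.ofReal (h * (s * h)⁻¹ ^ d) * eLpNorm g 1 (volume.restrict T) := by
        rw [lintegral_const_mul' _ _ ENNReal.ofReal_ne_top, eLpNorm_one_eq_lintegral_enorm]
    _ ≤ ENNReal.ofReal (h * (s * h)⁻¹ ^ d) *
          (eLpNorm g (ENNReal.ofReal p) (volume.restrict T) *
            (volume T) ^ (1 - 1 / p)) := by
        gcongr
        have h1 := eLpNorm_le_eLpNorm_mul_rpow_measure_univ (p := 1) (q := ENNReal.ofReal p)
          (by simpa using hp) (hg.mono_measure (Measure.restrict_mono (hTQ.trans hQ) le_rfl))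
        simpa [ENNReal.toReal_ofReal (zero_le_one.trans hp)] using h1
    _ ≤ ENNReal.ofReal (h * (s * h)⁻¹ ^ d) *
          (eLpNorm g (ENNReal.ofReal p) (volume.restrict (Icc a (fun j => a j + h))) *
            (volume T) ^ (1 - 1 / p)) := by
        gcongr
    _ = _ := by
        rw [hvol, ENNReal.ofReal_rpow_of_pos (by positivity), mul_comm (eLpNorm _ _ _), ← mul_assoc,
          ← ENNReal.ofReal_mul (by positivity)]
        congr 2
        rw [← Real.rpow_natCast, ← Real.rpow_natCast, ← Real.rpow_mul hsh.le, mul_assoc,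
          Real.inv_rpow hsh.le, ← Real.rpow_neg hsh.le, ← Real.rpow_add hsh]
        congr 2
        ring

/-- The average of `f` over the cube with corner `a` and side length `h`, weighted by `φ`. -/
noncomputable def weightedMean (φ f : (Fin d → ℝ) → ℝ) (a : Fin d → ℝ) (h : ℝ) : ℝ :=
  ∫ u in cube d, φ u * f (a + h • u)

/-- Substitution `y = b + (s * h) • u` with `b = x + s • (a - x)`. Both integrands vanish off the
cube, so the integrals may be taken over the whole space, where scaling and translation apply. -/
lemma integral_shrink_eq {φ f : (Fin d → ℝ) → ℝ} (hφs : tsupport φ ⊆ interior (cube d))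
    {x a : Fin d → ℝ} {h s : ℝ} (hh : 0 < h) (hs : s ∈ Ioo (0 : ℝ) 1)
    (ha : ∀ j, 0 ≤ a j ∧ a j + h ≤ 1) (hx : x ∈ cube d) :
    ∫ u in cube d, φ u * f (x + s • (a + h • u - x)) =
      ∫ y in cube d, f y * shrinkDensity φ x a h s y := by
  obtain ⟨hs0, hs1⟩ := hs
  have hsh : 0 < s * h := mul_pos hs0 hh
  have h0 : ∀ u ∉ cube d, φ u = 0 := fun u hu => by
    by_contra h
    exact hu (interior_subset (hφs (subset_tsupport φ h)))
  rw [setIntegral_eq_integral_of_forall_compl_eq_zero (fun u hu => by rw [h0 u hu, zero_mul]),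
    setIntegral_eq_integral_of_forall_compl_eq_zero]
  · set b : Fin d → ℝ := x + s • (a - x) with hb
    have h1 : ∀ u, φ u * f (x + s • (a + h • u - x)) =
        (fun v => φ ((s * h)⁻¹ • v) * f (v + b)) ((s * h) • u) := by
      intro u
      simp only
      rw [inv_smul_smul₀ hsh.ne']
      congr 2
      ext i
      simp [hb]
      ring
    rw [integral_congr_ae (Filter.Eventually.of_forall h1),
      Measure.integral_comp_smul volume (fun v => φ ((s * h)⁻¹ • v) * f (v + b)),
      ← integral_sub_right_eq_self _ b, ← integral_smul]
    congr 1
    ext y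
    have h2 : shrinkInv x a h s y = (s * h)⁻¹ • (y - b) := by
      ext i
      simp only [shrinkInv, hb, Pi.smul_apply, Pi.sub_apply, Pi.add_apply, smul_eq_mul]
      field_simp
      ring
    have h3 : |((s * h) ^ d)⁻¹| = (s * h)⁻¹ ^ d := by
      rw [inv_pow, abs_of_pos (by positivity)]
    simp only [shrinkDensity, h2, Module.finrank_fin_fun, smul_eq_mul, sub_add_cancel, h3]
    ring
  · intro y hy
    by_contra h
    have h1 : φ (shrinkInv x a _ s y) ≠ 0 := right_ne_zero_of_mul (right_ne_zero_of_mul h)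
    exact hy (interior_subset (mem_interior_cube_of_shrinkInv_mem hh ⟨hs0, hs1⟩ ha hx
      (hφs (subset_tsupport φ h1))))

/-- If `|F'(s)| ≤ B s^{-α}` on `(0,1)` with `α < 1`, then `|F(1) - F(0)| ≤ B / (1 - α)`. -/
lemma abs_sub_le_of_abs_deriv_le_rpow {F F' : ℝ → ℝ} {B α : ℝ} (hα : α < 1)
    (hF : ContinuousOn F (Icc 0 1)) (hF' : ∀ s ∈ Ioo (0 : ℝ) 1, HasDerivAt F (F' s) s)
    (hB : ∀ s ∈ Ioo (0 : ℝ) 1, |F' s| ≤ B * s ^ (-α)) :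
    |F 1 - F 0| ≤ B / (1 - α) := by
  have hα' : 0 < 1 - α := by linarith
  -- `G` is a primitive of the bound. Monotonicity of `G ± F` replaces integrating `F'`, so no
  -- integrability of `F'` has to be shown.
  set G : ℝ → ℝ := fun s => B / (1 - α) * s ^ (1 - α) with hG
  have hGc : ContinuousOn G (Icc 0 1) := by
    exact continuousOn_const.mul (continuousOn_id.rpow_const fun s _ => Or.inr hα'.le)
  have hG' : ∀ s ∈ Ioo (0 : ℝ) 1, HasDerivAt G (B * s ^ (-α)) s := by
    intro s hs
    refine ((Real.hasDerivAt_rpow_const (p := 1 - α) (Or.inl hs.1.ne')).const_mul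
      (B / (1 - α))).congr_deriv ?_
    rw [show 1 - α - 1 = -α by ring]
    field_simp
  have hG0 : G 0 = 0 := by simp [hG, Real.zero_rpow hα'.ne']
  have hG1 : G 1 = B / (1 - α) := by simp [hG]
  have key : ∀ σ : ℝ, |σ| = 1 → 0 ≤ B / (1 - α) + σ * (F 1 - F 0) := by
    intro σ hσ
    have hd : ∀ s ∈ Ioo (0 : ℝ) 1, HasDerivAt (fun s => G s + σ * F s)
        (B * s ^ (-α) + σ * F' s) s := fun s hs => (hG' s hs).add ((hF' s hs).const_mul σ)
    have hm : MonotoneOn (fun s => G s + σ * F s) (Icc 0 1) := by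
      refine monotoneOn_of_deriv_nonneg (convex_Icc 0 1) (hGc.add (continuousOn_const.mul hF)) ?_ ?_
      · rw [interior_Icc]
        exact fun s hs => (hd s hs).differentiableAt.differentiableWithinAt
      · rw [interior_Icc]
        intro s hs
        rw [(hd s hs).deriv]
        have h1 := hB s hs
        have h2 : |σ * F' s| = |F' s| := by rw [abs_mul, hσ, one_mul]
        have h3 := neg_abs_le (σ * F' s)
        linarith
    have h1 := hm (left_mem_Icc.2 zero_le_one) (right_mem_Icc.2 zero_le_one) zero_le_one
    simp only [hG0, hG1] at h1
    linarith
  have h1 := key 1 (by simp)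
  have h2 := key (-1) (by simp)
  rw [abs_le]
  constructor <;> linarith

lemma eLpNorm_restrict_ne_top_of_subset {g : (Fin d → ℝ) → ℝ} {p : ℝ≥0∞} {s : Set (Fin d → ℝ)}
    (hs : s ⊆ cube d) (hg : eLpNorm g p (volume.restrict (cube d)) ≠ ∞) :
    eLpNorm g p (volume.restrict s) ≠ ∞ :=
  ((eLpNorm_mono_measure g (Measure.restrict_mono hs le_rfl)).trans_lt hg.lt_top).ne

/-- A Morrey inequality: on a subcube of side length `h`, the function `f` differs from a constant
by at most a multiple of `h^{1-d/p}` times the `L_p`-norm of the weak gradient on that subcube. -/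
theorem abs_sub_weightedMean_le {φ f : (Fin d → ℝ) → ℝ}
    {g : Fin d → (Fin d → ℝ) → ℝ} (hf : Continuous f) (hg : IsWeakGradient f g)
    (hφ : ContDiff ℝ (⊤ : ℕ∞) φ) (hφs : tsupport φ ⊆ interior (cube d))
    (hφ0 : ∀ x, 0 ≤ φ x) (hφ1 : ∀ x, φ x ≤ 1) {p : ℝ} (hp1 : 1 ≤ p) (hp : (d : ℝ) < p)
    (hgp : ∀ j, eLpNorm (g j) (ENNReal.ofReal p) (volume.restrict (cube d)) ≠ ∞)
    {x a : Fin d → ℝ} {h : ℝ} (hh : 0 < h)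
    (ha : ∀ j, 0 ≤ a j ∧ a j + h ≤ 1) (hx : x ∈ Icc a (fun j => a j + h)) :
    |weightedMean φ f a h - (∫ u, φ u) * f x| ≤
      (h ^ (1 - d / p) * ∑ j, (eLpNorm (g j) (ENNReal.ofReal p)
        (volume.restrict (Icc a (fun j => a j + h)))).toReal) / (1 - d / p) := by
  have hQ : Icc a (fun j => a j + h) ⊆ cube d := by
    intro y hy
    exact mem_cube.2 fun i => ⟨(ha i).1.trans (hy.1 i), (hy.2 i).trans (ha i).2⟩
  set S := ∑ j, (eLpNorm (g j) (ENNReal.ofReal p)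
        (volume.restrict (Icc a (fun j => a j + h)))).toReal with hS
  -- `F` interpolates between `(∫ φ) * f x` at `s = 0` and the weighted mean at `s = 1`; the bound
  -- on its derivative has exponent `α = d / p < 1`.
  set F : ℝ → ℝ := fun s => ∫ u in cube d, φ u * f (x + s • (a + h • u - x)) with hF
  have hFc : Continuous F := by
    refine continuous_parametric_integral_of_continuous
      (f := fun (s : ℝ) u => φ u * f (x + s • (a + h • u - x))) ?_ (isCompact_cube d)
    have := hφ.continuous
    simp only [Function.uncurry_def]
    fun_prop
  have hF1 : F 1 = weightedMean φ f a h := by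
    simp [hF, weightedMean]
  have hF0 : F 0 = (∫ u, φ u) * f x := by
    simp only [hF, zero_smul, add_zero]
    rw [integral_mul_const, setIntegral_eq_integral_of_forall_compl_eq_zero]
    intro u hu
    by_contra h
    exact hu (interior_subset (hφs (subset_tsupport φ h)))
  rw [← hF1, ← hF0]
  refine abs_sub_le_of_abs_deriv_le_rpow
    (F' := fun s => ∑ j, ∫ y in cube d, g j y * shrinkFlux φ x a h s j y)
    ?_ hFc.continuousOn ?_ ?_
  · exact (div_lt_one (zero_lt_one.trans_le hp1)).2 hp
  · intro s hs
    refine (hasDerivAt_integral_shrinkDensity hf hg hφ hφs hh hs ha (hQ hx)).congr_of_eventuallyEq ?_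
    filter_upwards [Ioo_mem_nhds hs.1 hs.2] with t ht
    exact integral_shrink_eq hφs hh ht ha (hQ hx)
  · intro s hs
    have hs0 := hs.1
    have hb : ∀ j, |∫ y in cube d, g j y * shrinkFlux φ x a h s j y| ≤
        (h * (s * h) ^ (-(d / p))) * (eLpNorm (g j) (ENNReal.ofReal p)
        (volume.restrict (Icc a (fun j => a j + h)))).toReal := by
      intro j
      have h1 := enorm_integral_mul_shrinkFlux_le (hg.aestronglyMeasurable j) hφs hφ0 hφ1 hp1 hh hs
        ha hx j
      have h2 := ENNReal.toReal_mono (ENNReal.mul_ne_top ENNReal.ofReal_ne_top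
        (eLpNorm_restrict_ne_top_of_subset hQ (hgp j))) h1
      rwa [ENNReal.toReal_mul, ENNReal.toReal_ofReal (by positivity), toReal_enorm,
        Real.norm_eq_abs] at h2
    calc |∑ j, ∫ y in cube d, g j y * shrinkFlux φ x a h s j y|
        ≤ ∑ j, |∫ y in cube d, g j y * shrinkFlux φ x a h s j y| := Finset.abs_sum_le_sum_abs _ _
      _ ≤ ∑ j, (h * (s * h) ^ (-(d / p))) * (eLpNorm (g j) (ENNReal.ofReal p)
        (volume.restrict (Icc a (fun j => a j + h)))).toReal := Finset.sum_le_sum fun j _ => hb j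
      _ = h ^ (1 - d / p) * S * s ^ (-(d / p)) := by
        rw [← Finset.mul_sum, Real.mul_rpow hs0.le hh.le, sub_eq_add_neg, Real.rpow_add hh,
          Real.rpow_one]
        ring

end Morrey

/-! ### Norms of finite sequences -/

lemma sum_le_card_mul_of_sum_rpow_le {ι : Type*} [Fintype ι] {a : ι → ℝ} (ha : ∀ i, 0 ≤ a i)
    {p L : ℝ} (hp : 1 ≤ p) (hL : 0 ≤ L)
    (h : ∑ i, a i ^ p ≤ L ^ p * Fintype.card ι) : ∑ i, a i ≤ Fintype.card ι * L := by
  have hp0 : 0 < p := zero_lt_one.trans_le hp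
  have h1 := Real.rpow_sum_le_const_mul_sum_rpow_of_nonneg Finset.univ hp (fun i _ => ha i)
  rw [Finset.card_univ] at h1
  rw [← Real.rpow_le_rpow_iff (Finset.sum_nonneg fun i _ => ha i) (by positivity) hp0]
  refine h1.trans ?_
  rcases (Nat.cast_nonneg (α := ℝ) (Fintype.card ι)).eq_or_lt with hN | hN
  · have : IsEmpty ι := Fintype.card_eq_zero_iff.1 (by exact_mod_cast hN.symm)
    simp
    positivity
  calc (Fintype.card ι : ℝ) ^ (p - 1) * ∑ i, a i ^ p
      ≤ (Fintype.card ι : ℝ) ^ (p - 1) * (L ^ p * Fintype.card ι) := by gcongr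
    _ = _ := by
      rw [Real.mul_rpow hN.le hL, Real.rpow_sub_one hN.ne']
      field_simp

/-- For `p ≤ 2` every `a i` is at most the `ℓ_p`-norm, so `2 - p` of the two powers can be pulled
out. For `p ≥ 2` it is the power mean inequality with exponent `p / 2`. -/
lemma sum_sq_le_of_sum_rpow_le {ι : Type*} [Fintype ι] {a : ι → ℝ} (ha : ∀ i, 0 ≤ a i)
    {p L : ℝ} (hp : 1 ≤ p) (hL : 0 ≤ L)
    (h : ∑ i, a i ^ p ≤ L ^ p * Fintype.card ι) :
    ∑ i, a i ^ 2 ≤ L ^ 2 * (Fintype.card ι : ℝ) ^ (2 / min p 2) := by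
  have hp0 : 0 < p := zero_lt_one.trans_le hp
  rcases le_total p 2 with hp2 | hp2
  · rw [min_eq_left hp2]
    set T := L ^ p * Fintype.card ι with hT
    have hT0 : 0 ≤ T := by positivity
    have h1 : ∀ i, a i ^ 2 ≤ a i ^ p * T ^ ((2 - p) / p) := by
      intro i
      have h2 : a i ^ p ≤ T := (Finset.single_le_sum (f := fun i => a i ^ p)
        (fun i _ => Real.rpow_nonneg (ha i) p) (Finset.mem_univ i)).trans h
      have h3 : a i ^ (2 - p) ≤ T ^ ((2 - p) / p) := by
        have h4 := Real.rpow_le_rpow (Real.rpow_nonneg (ha i) p) h2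
          (by have : 0 ≤ 2 - p := by linarith
              positivity : 0 ≤ (2 - p) / p)
        rwa [← Real.rpow_mul (ha i), mul_div_cancel₀ _ hp0.ne'] at h4
      calc a i ^ 2 = a i ^ p * a i ^ (2 - p) := by
            rw [← Real.rpow_add' (ha i) (by norm_num), add_sub_cancel, Real.rpow_two]
        _ ≤ _ := by
            have := Real.rpow_nonneg (ha i) p
            gcongr
    calc ∑ i, a i ^ 2 ≤ ∑ i, a i ^ p * T ^ ((2 - p) / p) := Finset.sum_le_sum fun i _ => h1 i
      _ = (∑ i, a i ^ p) * T ^ ((2 - p) / p) := by rw [Finset.sum_mul]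
      _ ≤ T * T ^ ((2 - p) / p) := by gcongr
      _ = T ^ (2 / p) := by
        have h5 : 2 / p = 1 + (2 - p) / p := by field_simp; ring
        rw [h5, Real.rpow_add' hT0 (by rw [← h5]; positivity), Real.rpow_one]
      _ = L ^ 2 * (Fintype.card ι : ℝ) ^ (2 / p) := by
        rw [hT, Real.mul_rpow (by positivity) (by positivity), ← Real.rpow_mul hL,
          mul_div_cancel₀ _ hp0.ne', Real.rpow_two]
  · rw [min_eq_right hp2, div_self two_ne_zero, Real.rpow_one, mul_comm]
    refine sum_le_card_mul_of_sum_rpow_le (p := p / 2) (fun i => sq_nonneg _) (by linarith)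
      (sq_nonneg L) ?_
    have h1 : ∀ x : ℝ, 0 ≤ x → (x ^ 2) ^ (p / 2) = x ^ p := by
      intro x hx
      rw [← Real.rpow_two, ← Real.rpow_mul hx]
      congr 1
      ring
    simp_rw [h1 L hL, h1 _ (ha _)]
    exact h

/-! ### Hoeffding's inequality -/

/-- By Hoeffding's lemma an interval of length `2 * a i` gives sub-Gaussian parameter `a i ^ 2`.
Parameters add under independence and may be raised to `V`; a union bound over both tails gives the
factor `2`. -/
lemma measure_abs_sum_sub_integral_ge_le {ι Ω : Type*} [Fintype ι] {mΩ : MeasurableSpace Ω}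
    {P : Measure Ω} [IsProbabilityMeasure P] {Y : ι → Ω → ℝ} (hind : iIndepFun Y P)
    (hY : ∀ i, AEMeasurable (Y i) P) {c a : ι → ℝ} (ha : ∀ i, 0 ≤ a i)
    (hmem : ∀ i, ∀ᵐ ω ∂P, Y i ω ∈ Icc (c i - a i) (c i + a i)) {V t : ℝ}
    (hV : ∑ i, a i ^ 2 ≤ V) (ht : 0 ≤ t) :
    P {ω | t ≤ |∑ i, (Y i ω - ∫ x, Y i x ∂P)|} ≤
      ENNReal.ofReal (2 * Real.exp (-t ^ 2 / (2 * V))) := by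
  have hV0 : 0 ≤ V := (Finset.sum_nonneg fun i _ => sq_nonneg (a i)).trans hV
  have h1 : ∀ i, HasSubgaussianMGF (fun ω => Y i ω - ∫ x, Y i x ∂P)
      ((‖(c i + a i) - (c i - a i)‖₊ / 2) ^ 2) P := fun i =>
    hasSubgaussianMGF_of_mem_Icc (hY i) (hmem i)
  have h2 : iIndepFun (fun i ω => Y i ω - ∫ x, Y i x ∂P) P :=
    hind.comp (fun i y => y - ∫ x, Y i x ∂P) (fun i => by fun_prop)
  have h3 := HasSubgaussianMGF.sum_of_iIndepFun h2 (s := Finset.univ) (fun i _ => h1 i)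
  have h4 : ((∑ i, (‖(c i + a i) - (c i - a i)‖₊ / 2) ^ 2 : NNReal) : ℝ) ≤ (V.toNNReal : ℝ) := by
    rw [Real.coe_toNNReal _ hV0]
    push_cast
    refine le_trans (le_of_eq (Finset.sum_congr rfl fun i _ => ?_)) hV
    rw [Real.norm_eq_abs, show (c i + a i) - (c i - a i) = 2 * a i by ring,
      abs_of_nonneg (by linarith [ha i])]
    ring
  have h5 : HasSubgaussianMGF (fun ω => ∑ i, (Y i ω - ∫ x, Y i x ∂P)) V.toNNReal P :=
    ⟨h3.integrable_exp_mul, fun s => (h3.mgf_le s).trans (by gcongr)⟩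
  have h6 := h5.measure_ge_le ht
  have h7 := h5.neg.measure_ge_le ht
  rw [Real.coe_toNNReal _ hV0] at h6 h7
  have h8 : {ω | t ≤ |∑ i, (Y i ω - ∫ x, Y i x ∂P)|} ⊆
      {ω | t ≤ ∑ i, (Y i ω - ∫ x, Y i x ∂P)} ∪
        {ω | t ≤ (-fun ω => ∑ i, (Y i ω - ∫ x, Y i x ∂P)) ω} := fun ω hω => by
    simpa only [mem_union, mem_ofPred_eq, Pi.neg_apply] using le_abs.1 hω
  rw [← ofReal_measureReal]
  apply ENNReal.ofReal_le_ofReal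
  have h9 := (measureReal_mono h8).trans (measureReal_union_le (μ := P) _ _)
  linarith

/-- Each value and its mean lie within `a i` of `c i`. This deterministic estimate takes over when
`δ` is too small for Hoeffding to help. -/
lemma abs_sum_sub_integral_le {ι Ω : Type*} [Fintype ι] {mΩ : MeasurableSpace Ω}
    {P : Measure Ω} [IsProbabilityMeasure P] {Y : ι → Ω → ℝ}
    (hY : ∀ i, AEMeasurable (Y i) P) {c a : ι → ℝ}
    (hmem : ∀ i, ∀ᵐ ω ∂P, Y i ω ∈ Icc (c i - a i) (c i + a i)) :
    ∀ᵐ ω ∂P, |∑ i, (Y i ω - ∫ x, Y i x ∂P)| ≤ 2 * ∑ i, a i := by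
  have h1 : ∀ i, |(∫ x, Y i x ∂P) - c i| ≤ a i := by
    intro i
    have hi : Integrable (Y i) P := Integrable.of_mem_Icc _ _ (hY i) (hmem i)
    have h2 := norm_integral_le_of_norm_le_const (μ := P) (f := fun ω => Y i ω - c i) (C := a i) (by
      filter_upwards [hmem i] with ω hω
      rw [Real.norm_eq_abs, abs_le]
      constructor <;> linarith [hω.1, hω.2])
    rw [integral_sub hi (integrable_const _)] at h2
    simpa using h2
  filter_upwards [ae_all_iff.2 hmem] with ω hω
  refine (Finset.abs_sum_le_sum_abs _ _).trans ?_
  rw [Finset.mul_sum]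
  refine Finset.sum_le_sum fun i _ => ?_
  have h2 := abs_le.1 (h1 i)
  have h3 := hω i
  rw [abs_le]
  constructor <;> linarith [h3.1, h3.2, h2.1, h2.2]

/-! ### The partition into subcubes -/

section Subcube

variable {d m : ℕ}

/-- The lower corner of a subcube. -/
noncomputable def corner (i : Fin d → Fin m) : Fin d → ℝ := fun j => ((i j : ℕ) : ℝ) / m

lemma subcube_eq (i : Fin d → Fin m) :
    subcube i = Set.pi univ fun j => Ico (corner i j) (corner i j + (m : ℝ)⁻¹) := by
  ext x
  simp [subcube, corner, add_div]

lemma measurableSet_subcube (i : Fin d → Fin m) : MeasurableSet (subcube i) := by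
  rw [subcube_eq]
  exact MeasurableSet.univ_pi fun j => measurableSet_Ico

lemma subcube_ae_eq (i : Fin d → Fin m) :
    subcube i =ᵐ[volume] Icc (corner i) (fun j => corner i j + (m : ℝ)⁻¹) := by
  rw [subcube_eq]
  exact Measure.univ_pi_Ico_ae_eq_Icc

lemma subcube_subset_Icc (i : Fin d → Fin m) :
    subcube i ⊆ Icc (corner i) (fun j => corner i j + (m : ℝ)⁻¹) := by
  rw [subcube_eq, ← pi_univ_Icc]
  exact Set.pi_mono fun j _ => Ico_subset_Icc_self

lemma corner_bounds (hm : 0 < m) (i : Fin d → Fin m) (j : Fin d) :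
    0 ≤ corner i j ∧ corner i j + (m : ℝ)⁻¹ ≤ 1 := by
  have hm' : (0 : ℝ) < m := by exact_mod_cast hm
  have h1 : ((i j : ℕ) : ℝ) + 1 ≤ m := by exact_mod_cast (i j).2
  refine ⟨by unfold corner; positivity, ?_⟩
  unfold corner
  rw [← one_div, ← add_div, div_le_one hm']
  exact h1

lemma subcube_subset_cube (hm : 0 < m) (i : Fin d → Fin m) : subcube i ⊆ cube d := by
  intro x hx
  have h1 := subcube_subset_Icc i hx
  exact mem_cube.2 fun j => ⟨(corner_bounds hm i j).1.trans (h1.1 j),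
    (h1.2 j).trans (corner_bounds hm i j).2⟩

lemma volume_subcube (i : Fin d → Fin m) :
    volume (subcube i) = ENNReal.ofReal ((m : ℝ)⁻¹ ^ d) := by
  rw [measure_congr (subcube_ae_eq i), Real.volume_Icc_pi]
  simp [-inv_pow, ENNReal.ofReal_pow]

lemma pairwise_disjoint_subcube (hm : 0 < m) :
    Pairwise (Function.onFun Disjoint (subcube : (Fin d → Fin m) → Set (Fin d → ℝ))) := by
  intro i i' hne
  rw [Function.onFun, Set.disjoint_left]
  intro x hx hx'
  apply hne
  have hm' : (0 : ℝ) < m := by exact_mod_cast hm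
  ext j
  have h1 := hx j
  have h2 := hx' j
  rw [div_le_iff₀ hm', lt_div_iff₀ hm'] at h1 h2
  have h3 : ((i j : ℕ) : ℝ) < ((i' j : ℕ) : ℝ) + 1 := by linarith
  have h4 : ((i' j : ℕ) : ℝ) < ((i j : ℕ) : ℝ) + 1 := by linarith
  have h5 : (i j : ℕ) < (i' j : ℕ) + 1 := by exact_mod_cast h3
  have h6 : (i' j : ℕ) < (i j : ℕ) + 1 := by exact_mod_cast h4
  omega

lemma iUnion_subcube (hm : 0 < m) :
    ⋃ i : Fin d → Fin m, subcube i = Set.pi univ fun _ => Ico (0 : ℝ) 1 := by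
  have hm' : (0 : ℝ) < m := by exact_mod_cast hm
  ext x
  simp only [mem_iUnion, mem_univ_pi, mem_Ico]
  constructor
  · rintro ⟨i, hi⟩ j
    obtain ⟨h1, h2⟩ := hi j
    have h3 := corner_bounds hm i j
    simp only [corner] at h3
    refine ⟨h3.1.trans h1, h2.trans_le ?_⟩
    rw [add_div, one_div]
    exact h3.2
  · intro hx
    have h1 : ∀ j, ⌊x j * m⌋₊ < m := fun j => by
      rw [Nat.floor_lt (mul_nonneg (hx j).1 hm'.le)]
      nlinarith [(hx j).2]
    refine ⟨fun j => ⟨⌊x j * m⌋₊, h1 j⟩, fun j => ⟨?_, ?_⟩⟩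
    · rw [div_le_iff₀ hm']
      exact Nat.floor_le (mul_nonneg (hx j).1 hm'.le)
    · rw [lt_div_iff₀ hm']
      exact Nat.lt_floor_add_one _

lemma iUnion_subcube_ae_eq (hm : 0 < m) :
    ⋃ i : Fin d → Fin m, subcube i =ᵐ[volume] cube d := by
  rw [iUnion_subcube hm]
  exact Measure.univ_pi_Ico_ae_eq_Icc

lemma sum_lintegral_subcube (hm : 0 < m) (F : (Fin d → ℝ) → ℝ≥0∞) :
    ∑ i : Fin d → Fin m, ∫⁻ x in subcube i, F x = ∫⁻ x in cube d, F x := by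
  rw [← setLIntegral_congr (iUnion_subcube_ae_eq hm),
    lintegral_iUnion measurableSet_subcube (pairwise_disjoint_subcube hm), tsum_fintype]

lemma sum_integral_subcube (hm : 0 < m) {f : (Fin d → ℝ) → ℝ} (hf : IntegrableOn f (cube d)) :
    ∑ i : Fin d → Fin m, ∫ x in subcube i, f x = ∫ x in cube d, f x := by
  rw [← setIntegral_congr_set (iUnion_subcube_ae_eq hm),
    integral_iUnion_fintype measurableSet_subcube (pairwise_disjoint_subcube hm)
      (fun i => hf.mono_set (subcube_subset_cube hm i))]

/-- The `p`-th power of the `L_p`-norm is an integral, hence additive over the partition; closed and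
half-open subcubes differ by null sets. -/
lemma sum_eLpNorm_rpow_subcube (hm : 0 < m) {p : ℝ} (hp : 0 < p) (g : (Fin d → ℝ) → ℝ)
    (hg : eLpNorm g (ENNReal.ofReal p) (volume.restrict (cube d)) ≤ 1) :
    ∑ i : Fin d → Fin m, (eLpNorm g (ENNReal.ofReal p) (volume.restrict
      (Icc (corner i) (fun j => corner i j + (m : ℝ)⁻¹)))).toReal ^ p ≤ 1 := by
  have h0 : ∀ s : Set (Fin d → ℝ), eLpNorm g (ENNReal.ofReal p) (volume.restrict s) ^ p =
      ∫⁻ x in s, ‖g x‖ₑ ^ p := by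
    intro s
    rw [eLpNorm_eq_lintegral_rpow_enorm_toReal (by simpa using hp) ENNReal.ofReal_ne_top,
      ENNReal.toReal_ofReal hp.le, ← ENNReal.rpow_mul, one_div_mul_cancel hp.ne', ENNReal.rpow_one]
  have h1 : ∑ i : Fin d → Fin m, eLpNorm g (ENNReal.ofReal p) (volume.restrict
      (Icc (corner i) (fun j => corner i j + (m : ℝ)⁻¹))) ^ p ≤ 1 := by
    simp_rw [h0]
    rw [Finset.sum_congr rfl fun i _ => (setLIntegral_congr (subcube_ae_eq i)).symm,
      sum_lintegral_subcube hm, ← h0]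
    exact ENNReal.rpow_le_one hg hp.le
  have h2 : ∀ i : Fin d → Fin m, eLpNorm g (ENNReal.ofReal p) (volume.restrict
      (Icc (corner i) (fun j => corner i j + (m : ℝ)⁻¹))) ^ p ≠ ∞ := fun i =>
    ((Finset.single_le_sum (fun i _ => zero_le) (Finset.mem_univ i)).trans h1).trans_lt
      ENNReal.one_lt_top |>.ne
  simp_rw [ENNReal.toReal_rpow]
  rw [← ENNReal.toReal_sum fun i _ => h2 i]
  exact ENNReal.toReal_le_of_le_ofReal zero_le_one (by simpa using h1)

end Subcube

/-! ### The error of stratified sampling -/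

section Stratified

variable {d m : ℕ}

lemma IsStratifiedSample.ae_mem {Ω : Type*} [MeasurableSpace Ω] {P : Measure Ω}
    {X : (Fin d → Fin m) → Ω → (Fin d → ℝ)} (hX : IsStratifiedSample P X) (i : Fin d → Fin m) :
    ∀ᵐ ω ∂P, X i ω ∈ subcube i := by
  refine ae_of_ae_map (hX.1 i).aemeasurable (p := fun x => x ∈ subcube i) ?_
  rw [hX.2.2 i]
  exact ae_cond_mem (measurableSet_subcube i)

lemma IsStratifiedSample.integral_eq {Ω : Type*} [MeasurableSpace Ω] {P : Measure Ω}
    {X : (Fin d → Fin m) → Ω → (Fin d → ℝ)} (hX : IsStratifiedSample P X)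
    {f : (Fin d → ℝ) → ℝ} (hf : Continuous f) (i : Fin d → Fin m) :
    ∫ ω, f (X i ω) ∂P = (m : ℝ) ^ d * ∫ x in subcube i, f x := by
  rw [← integral_map (hX.1 i).aemeasurable hf.aestronglyMeasurable, hX.2.2 i,
    ProbabilityTheory.cond, integral_smul_measure, volume_subcube, ENNReal.toReal_inv,
    ENNReal.toReal_ofReal (by positivity), inv_pow, inv_inv, smul_eq_mul]

/-- Stratified sampling is unbiased: the mean of `f (X i)` is `m ^ d` times the integral over its
subcube, and these integrals add up to the one over the cube. -/
lemma IsStratifiedSample.stratified_sub_integralCube {Ω : Type*} [MeasurableSpace Ω]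
    {P : Measure Ω} {X : (Fin d → Fin m) → Ω → (Fin d → ℝ)} (hX : IsStratifiedSample P X)
    (hm : 0 < m) {f : (Fin d → ℝ) → ℝ} (hf : Continuous f) (ω : Ω) :
    stratified X ω f - integralCube d f =
      1 / (m : ℝ) ^ d * ∑ i, (f (X i ω) - ∫ x, f (X i x) ∂P) := by
  have hm' : (0 : ℝ) < m := by exact_mod_cast hm
  rw [Finset.sum_sub_distrib, mul_sub, stratified]
  simp_rw [hX.integral_eq hf]
  rw [← Finset.mul_sum, sum_integral_subcube hm
    (hf.continuousOn.integrableOn_compact (isCompact_cube d)), integralCube]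
  field_simp

/-- The deviation of `f` from a constant on each of the subcubes. -/
lemma exists_deviation_bound (d : ℕ) (hd : 1 ≤ d) {p : ℝ} (hp : (d : ℝ) < p) :
    ∃ A : ℝ, 0 < A ∧ ∀ (f : (Fin d → ℝ) → ℝ) (g : Fin d → (Fin d → ℝ) → ℝ), Continuous f →
      IsWeakGradient f g →
      (∀ j, eLpNorm (g j) (ENNReal.ofReal p) (volume.restrict (cube d)) ≤ 1) →
      ∀ m : ℕ, 0 < m → ∃ c a : (Fin d → Fin m) → ℝ, (∀ i, 0 ≤ a i) ∧
        (∀ i, ∀ x ∈ subcube i, f x ∈ Icc (c i - a i) (c i + a i)) ∧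
        ∑ i, a i ^ p ≤ (A * (m : ℝ)⁻¹) ^ p * (m : ℝ) ^ d := by
  obtain ⟨φ, hφ, -, hφs, hφ0, hφ1, hI⟩ := exists_bump d
  have hd' : (1 : ℝ) ≤ d := by exact_mod_cast hd
  have hp1 : 1 ≤ p := hd'.trans hp.le
  have hp0 : 0 < p := zero_lt_one.trans_le hp1
  set I := ∫ u, φ u with hIdef
  have hα : 0 < 1 - d / p := by
    rw [sub_pos, div_lt_one hp0]
    exact hp
  -- `1 - d / p` comes from integrating `s^{-d/p}`, and `I` normalizes the weighted mean, since `φ`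
  -- has mass `I`.
  set K := 1 / ((1 - d / p) * I) with hK
  have hK0 : 0 < K := by positivity
  refine ⟨K * d, by positivity, fun f g hf hg hgp m hm => ?_⟩
  have hm' : (0 : ℝ) < m := by exact_mod_cast hm
  set G : (Fin d → Fin m) → Fin d → ℝ := fun i j => (eLpNorm (g j) (ENNReal.ofReal p)
        (volume.restrict (Icc (corner i) (fun j => corner i j + (m : ℝ)⁻¹)))).toReal with hG
  have hG0 : ∀ i j, 0 ≤ G i j := fun i j => ENNReal.toReal_nonneg
  set B := K * (m : ℝ)⁻¹ ^ (1 - d / p) with hB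
  have hB0 : 0 ≤ B := by positivity
  refine ⟨fun i => weightedMean φ f (corner i) (m : ℝ)⁻¹ / I, fun i => B * ∑ j, G i j,
    fun i => mul_nonneg hB0 (Finset.sum_nonneg fun j _ => hG0 i j), fun i x hx => ?_, ?_⟩
  · have h1 : |weightedMean φ f (corner i) (m : ℝ)⁻¹ - I * f x| ≤
        ((m : ℝ)⁻¹ ^ (1 - d / p) * ∑ j, G i j) / (1 - d / p) := abs_sub_weightedMean_le hf hg hφ hφs hφ0 hφ1 hp1 hp
      (fun j => ((hgp j).trans_lt ENNReal.one_lt_top).ne) (inv_pos.2 hm') (corner_bounds hm i)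
      (subcube_subset_Icc i hx)
    have h2 : |weightedMean φ f (corner i) (m : ℝ)⁻¹ / I - f x| ≤ B * ∑ j, G i j := by
      have h3 : weightedMean φ f (corner i) (m : ℝ)⁻¹ / I - f x =
          (weightedMean φ f (corner i) (m : ℝ)⁻¹ - I * f x) / I := by
        field_simp
      rw [h3, abs_div, abs_of_pos hI, div_le_iff₀ hI]
      refine h1.trans (le_of_eq ?_)
      rw [hB, hK]
      field_simp
    rw [abs_le] at h2
    constructor <;> linarith [h2.1, h2.2]
  · calc ∑ i, (B * ∑ j, G i j) ^ p
        ≤ ∑ i, B ^ p * ((d : ℝ) ^ (p - 1) * ∑ j, G i j ^ p) := by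
          refine Finset.sum_le_sum fun i _ => ?_
          rw [Real.mul_rpow hB0 (Finset.sum_nonneg fun j _ => hG0 i j)]
          gcongr
          have := Real.rpow_sum_le_const_mul_sum_rpow_of_nonneg Finset.univ hp1
            (fun j _ => hG0 i j)
          simpa using this
      _ = B ^ p * (d : ℝ) ^ (p - 1) * ∑ j, ∑ i, G i j ^ p := by
          rw [Finset.sum_comm, Finset.mul_sum]
          refine Finset.sum_congr rfl fun i _ => by ring
      _ ≤ B ^ p * (d : ℝ) ^ (p - 1) * ∑ j : Fin d, 1 := by
          gcongr with j
          exact sum_eLpNorm_rpow_subcube hm hp0 (g j) (hgp j)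
      _ = _ := by
          have hd0 : (0 : ℝ) < d := by linarith
          simp only [Finset.sum_const, Finset.card_univ, Fintype.card_fin, nsmul_eq_mul, mul_one]
          rw [hB, Real.mul_rpow hK0.le (by positivity), ← Real.rpow_mul (by positivity),
            Real.rpow_sub_one hd0.ne', Real.mul_rpow (by positivity) (by positivity),
            Real.mul_rpow hK0.le hd0.le, sub_mul, div_mul_cancel₀ _ hp0.ne', one_mul,
            Real.rpow_sub (by positivity), Real.rpow_natCast, inv_pow]
          field_simp

theorem exists_stratified_bound (d : ℕ) (hd : 1 ≤ d) {p : ℝ} (hp : (d : ℝ) < p) :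
    ∃ A : ℝ, 0 < A ∧ ∀ (f : (Fin d → ℝ) → ℝ) (g : Fin d → (Fin d → ℝ) → ℝ), Continuous f →
      IsWeakGradient f g →
      (∀ j, eLpNorm (g j) (ENNReal.ofReal p) (volume.restrict (cube d)) ≤ 1) →
      ∀ m : ℕ, 0 < m → ∀ δ ∈ Ioo (0 : ℝ) (1 / 2),
      ∀ (Ω : Type*) [MeasurableSpace Ω] (P : Measure Ω) [IsProbabilityMeasure P]
        (X : (Fin d → Fin m) → Ω → (Fin d → ℝ)), IsStratifiedSample P X →
        P {ω | A * (m : ℝ)⁻¹ * min 1 (((m : ℝ) ^ d) ^ (-(1 - 1 / min p 2)) * √(Real.log δ⁻¹)) <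
          |stratified X ω f - integralCube d f|} ≤ ENNReal.ofReal δ := by
  obtain ⟨A, hA, H⟩ := exists_deviation_bound d hd hp
  -- The factor `2` is the one in the almost sure bound; in Hoeffding's inequality it makes the tail
  -- `2 * δ ^ 2`, which is at most `δ` for `δ < 1 / 2`.
  refine ⟨2 * A, by positivity, fun f g hf hg hgp m hm δ hδ Ω _ P _ X hX => ?_⟩
  obtain ⟨c, a, ha, hfa, hap⟩ := H f g hf hg hgp m hm
  have hm' : (0 : ℝ) < m := by exact_mod_cast hm
  have hd' : (1 : ℝ) ≤ d := by exact_mod_cast hd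
  have hp1 : 1 ≤ p := hd'.trans hp.le
  set L := A * (m : ℝ)⁻¹ with hL
  have hL0 : 0 < L := by positivity
  set N : ℝ := (m : ℝ) ^ d with hN
  have hN0 : 0 < N := by positivity
  have hcard : (Fintype.card (Fin d → Fin m) : ℝ) = N := by simp [hN]
  rw [← hcard] at hap
  have hsum1 := sum_le_card_mul_of_sum_rpow_le ha hp1 hL0.le hap
  have hsum2 := sum_sq_le_of_sum_rpow_le ha hp1 hL0.le hap
  rw [hcard] at hsum1 hsum2
  have hYm : ∀ i, AEMeasurable (fun ω => f (X i ω)) P := fun i =>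
    (hf.measurable.comp (hX.1 i)).aemeasurable
  have hmem : ∀ i, ∀ᵐ ω ∂P, f (X i ω) ∈ Icc (c i - a i) (c i + a i) := by
    intro i
    filter_upwards [hX.ae_mem i] with ω hω
    exact hfa i _ hω
  have hind : iIndepFun (fun i ω => f (X i ω)) P :=
    hX.2.1.comp (fun _ => f) (fun _ => hf.measurable)
  have herr : ∀ ω, N * |stratified X ω f - integralCube d f| =
      |∑ i, (f (X i ω) - ∫ x, f (X i x) ∂P)| := by
    intro ω
    rw [hX.stratified_sub_integralCube hm hf, abs_mul, abs_of_pos (by positivity)]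
    field_simp
    rw [hN, mul_comm]
  set q := min p 2 with hq
  have hq0 : 0 < q := lt_min (zero_lt_one.trans_le hp1) two_pos
  have hlog : 0 < Real.log δ⁻¹ := Real.log_pos (by
    rw [one_lt_inv₀ hδ.1]
    linarith [hδ.2])
  rcases le_total 1 (N ^ (-(1 - 1 / q)) * √(Real.log δ⁻¹)) with h1 | h1
  · rw [min_eq_left h1, mul_one]
    have h2 := abs_sum_sub_integral_le hYm hmem
    have h3 : P {ω | 2 * A * (m : ℝ)⁻¹ < |stratified X ω f - integralCube d f|} = 0 := by
      rw [measure_eq_zero_iff_ae_notMem]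
      filter_upwards [h2] with ω hω
      refine not_lt.2 ?_
      rw [← herr] at hω
      have h4 : N * |stratified X ω f - integralCube d f| ≤ N * (2 * L) := by linarith
      have h5 := le_of_mul_le_mul_left h4 hN0
      rw [hL] at h5
      linarith
    rw [h3]
    exact zero_le
  · rw [min_eq_right h1]
    set R := N ^ (-(1 - 1 / q)) * √(Real.log δ⁻¹) with hR
    have hR0 : 0 ≤ R := by positivity
    have h2 := measure_abs_sum_sub_integral_ge_le hind hYm ha hmem hsum2
      (t := N * (2 * L * R)) (by positivity)
    refine (measure_mono ?_).trans (h2.trans (ENNReal.ofReal_le_ofReal ?_))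
    · intro ω hω
      rw [mem_ofPred_eq] at hω ⊢
      rw [← herr]
      refine mul_le_mul_of_nonneg_left (le_of_eq_of_le ?_ hω.le) hN0.le
      rw [hL]
      ring
    · have h3 : R ^ 2 = N ^ (2 / q) / N ^ 2 * Real.log δ⁻¹ := by
        rw [hR, mul_pow, Real.sq_sqrt hlog.le, ← Real.rpow_natCast (N ^ _) 2, ← Real.rpow_mul hN0.le,
          ← Real.rpow_natCast N 2, ← Real.rpow_sub hN0]
        congr 2
        push_cast
        ring
      have h4 : -(N * (2 * L * R)) ^ 2 / (2 * (L ^ 2 * N ^ (2 / q))) = Real.log (δ ^ 2) := by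
        have : 0 < N ^ (2 / q) := by positivity
        rw [mul_pow, mul_pow, h3, Real.log_inv, Real.log_pow]
        field_simp
        push_cast
        ring
      rw [h4, Real.exp_log (by have := hδ.1; positivity)]
      nlinarith [hδ.1, hδ.2]

end Stratified

/-! ### Continuous extension to the whole space -/

/-- The projection of the whole space onto the cube. -/
noncomputable def cubeProj (d : ℕ) (x : Fin d → ℝ) : cube d :=
  ⟨fun j => max 0 (min 1 (x j)), mem_cube.2 fun _ =>
    ⟨le_max_left _ _, max_le zero_le_one (min_le_left _ _)⟩⟩

lemma continuous_cubeProj (d : ℕ) : Continuous (cubeProj d) := by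
  refine Continuous.subtype_mk (continuous_pi fun j => ?_) _
  fun_prop

lemma cubeProj_of_mem {d : ℕ} {x : Fin d → ℝ} (hx : x ∈ cube d) : (cubeProj d x : Fin d → ℝ) = x := by
  ext j
  have := mem_cube.1 hx j
  simp [cubeProj, this.1, this.2]

/-- Membership in the Sobolev space gives continuity on the cube only. The extension agrees there
with `f` and is continuous everywhere, which the Morrey argument and the measurability of `f (X i)`
use. -/
lemma continuous_comp_cubeProj {d : ℕ} {f : (Fin d → ℝ) → ℝ} (hf : ContinuousOn f (cube d)) :
    Continuous fun x => f (cubeProj d x) :=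
  (continuousOn_iff_continuous_domRestrict.1 hf).comp (continuous_cubeProj d)

lemma IsWeakGradient.congr {d : ℕ} {f f' : (Fin d → ℝ) → ℝ} {g : Fin d → (Fin d → ℝ) → ℝ}
    (hg : IsWeakGradient f g) (h : EqOn f f' (cube d)) : IsWeakGradient f' g := by
  refine fun j => ⟨(hg j).1, fun φ h1 h2 h3 => ?_⟩
  rw [← (hg j).2 φ h1 h2 h3]
  refine setIntegral_congr_fun (measurableSet_cube d) fun x hx => ?_
  simp only [h hx]

/-- The integrability exponent, replaced by a finite one in the case `p = ∞`. -/
noncomputable def finiteExponent (d : ℕ) (p : ℝ≥0∞) : ℝ := if p = ∞ then d + 1 else p.toReal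

lemma lt_finiteExponent {d : ℕ} {p : ℝ≥0∞} (hp : (d : ℝ≥0∞) < p) : (d : ℝ) < finiteExponent d p := by
  unfold finiteExponent
  split_ifs with h
  · linarith
  · simpa using (ENNReal.toReal_lt_toReal (ENNReal.natCast_ne_top d) h).2 hp

/-- The substitute `d + 1` for `∞` is at least `2`, so `q` is unaffected. -/
lemma min_finiteExponent {d : ℕ} (hd : 1 ≤ d) (p : ℝ≥0∞) :
    min (finiteExponent d p) 2 = (min p 2).toReal := by
  unfold finiteExponent
  split_ifs with h
  · have : (1 : ℝ) ≤ d := by exact_mod_cast hd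
    rw [min_eq_right (by linarith), h, min_eq_right le_top]
    simp
  · rw [ENNReal.toReal_min h (by simp)]
    simp

lemma eLpNorm_le_one_of_sobolevNorm_le_one {d : ℕ} {p : ℝ≥0∞} (hp : (d : ℝ≥0∞) < p)
    {f : (Fin d → ℝ) → ℝ} {g : Fin d → (Fin d → ℝ) → ℝ} (hg : IsWeakGradient f g)
    (h : sobolevNorm p f g ≤ 1) (j : Fin d) :
    eLpNorm (g j) (ENNReal.ofReal (finiteExponent d p)) (volume.restrict (cube d)) ≤ 1 := by
  unfold sobolevNorm at h
  unfold finiteExponent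
  split_ifs at h ⊢ with hpt
  · have h1 : eLpNorm (g j) ∞ (volume.restrict (cube d)) ≤ 1 :=
      (le_iSup (fun j => eLpNorm (g j) ∞ (volume.restrict (cube d))) j).trans
        ((le_max_right _ _).trans h)
    exact (eLpNorm_le_eLpNorm_of_exponent_le le_top (hg.aestronglyMeasurable j)).trans h1
  · have hp0 : 0 < p.toReal := ENNReal.toReal_pos (zero_le.trans_lt hp).ne' hpt
    rw [ENNReal.ofReal_toReal hpt]
    rw [← ENNReal.rpow_le_rpow_iff hp0, ENNReal.one_rpow]
    rw [← ENNReal.rpow_le_rpow_iff hp0, ENNReal.one_rpow, ← ENNReal.rpow_mul,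
      one_div_mul_cancel hp0.ne', ENNReal.rpow_one] at h
    exact ((Finset.single_le_sum (f := fun j =>
      eLpNorm (g j) p (volume.restrict (cube d)) ^ p.toReal) (fun _ _ => zero_le)
      (Finset.mem_univ j)).trans le_add_self).trans h

/-! ### The grid size -/

lemma gridSize_pow_le {d : ℕ} (hd : 1 ≤ d) (n : ℕ) : gridSize d n ^ d ≤ n := by
  have hd0 : (d : ℝ) ≠ 0 := by positivity
  have h1 : (gridSize d n : ℝ) ≤ (n : ℝ) ^ (1 / (d : ℝ)) := Nat.floor_le (by positivity)
  have h2 : (gridSize d n : ℝ) ^ d ≤ n := by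
    calc (gridSize d n : ℝ) ^ d ≤ ((n : ℝ) ^ (1 / (d : ℝ))) ^ d := by gcongr
      _ = n := by
        rw [← Real.rpow_natCast, ← Real.rpow_mul (by positivity), one_div_mul_cancel hd0,
          Real.rpow_one]
  exact_mod_cast h2

lemma one_le_rpow_one_div (d : ℕ) {n : ℕ} (hn : 1 ≤ n) : 1 ≤ (n : ℝ) ^ (1 / (d : ℝ)) :=
  Real.one_le_rpow (by exact_mod_cast hn) (by positivity)

lemma gridSize_pos (d : ℕ) {n : ℕ} (hn : 1 ≤ n) : 0 < gridSize d n :=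
  Nat.floor_pos.2 (one_le_rpow_one_div d hn)

lemma half_rpow_le_gridSize (d : ℕ) {n : ℕ} (hn : 1 ≤ n) :
    (n : ℝ) ^ (1 / (d : ℝ)) / 2 ≤ gridSize d n := by
  have h1 := Nat.lt_floor_add_one ((n : ℝ) ^ (1 / (d : ℝ)))
  have h2 : (1 : ℝ) ≤ gridSize d n := by exact_mod_cast gridSize_pos d hn
  unfold gridSize at *
  linarith

/-- Rounding down loses at most a factor `2` in `m`, hence `2 ^ d` in `m ^ d`; the exponent `1 - 1 /
q` lies in `[0, 1]`, so the loss in the second term is at most `2 ^ d`. -/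
lemma gridSize_rate_le {d : ℕ} (hd : 1 ≤ d) {q : ℝ} (hq : 1 ≤ q) {n : ℕ} (hn : 1 ≤ n) (δ : ℝ) :
    (gridSize d n : ℝ)⁻¹ *
      min 1 (((gridSize d n : ℝ) ^ d) ^ (-(1 - 1 / q)) * √(Real.log δ⁻¹)) ≤
      2 * 2 ^ d * rate d q n δ := by
  have hm : (0 : ℝ) < gridSize d n := by exact_mod_cast gridSize_pos d hn
  have hn0 : (0 : ℝ) < n := by exact_mod_cast hn
  have hd0 : (d : ℝ) ≠ 0 := by positivity
  have hh := half_rpow_le_gridSize d hn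
  have hβ0 : 0 ≤ 1 - 1 / q := by
    rw [sub_nonneg, div_le_one (by linarith)]
    exact hq
  have hβ1 : 1 - 1 / q ≤ 1 := by
    have : 0 ≤ 1 / q := by positivity
    linarith
  set β := 1 - 1 / q
  have h1 : (gridSize d n : ℝ)⁻¹ ≤ 2 * (n : ℝ) ^ (-(1 / (d : ℝ))) := by
    rw [Real.rpow_neg hn0.le]
    calc (gridSize d n : ℝ)⁻¹ ≤ ((n : ℝ) ^ (1 / (d : ℝ)) / 2)⁻¹ := by gcongr
      _ = _ := by rw [inv_div, div_eq_mul_inv]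
  have h2 : ((gridSize d n : ℝ) ^ d) ^ (-β) ≤ 2 ^ d * (n : ℝ) ^ (-β) := by
    have h3 : (n : ℝ) / 2 ^ d ≤ (gridSize d n : ℝ) ^ d := by
      calc (n : ℝ) / 2 ^ d = ((n : ℝ) ^ (1 / (d : ℝ)) / 2) ^ d := by
            rw [div_pow, ← Real.rpow_natCast (_ ^ _) d, ← Real.rpow_mul hn0.le,
              one_div_mul_cancel hd0, Real.rpow_one]
        _ ≤ _ := by gcongr
    calc ((gridSize d n : ℝ) ^ d) ^ (-β) ≤ ((n : ℝ) / 2 ^ d) ^ (-β) :=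
          Real.rpow_le_rpow_of_nonpos (by positivity) h3 (by linarith)
      _ = ((2 : ℝ) ^ d) ^ β * (n : ℝ) ^ (-β) := by
          rw [Real.div_rpow hn0.le (by positivity), Real.rpow_neg (by positivity : (0 : ℝ) ≤ 2 ^ d)]
          field_simp
      _ ≤ ((2 : ℝ) ^ d) ^ (1 : ℝ) * (n : ℝ) ^ (-β) := by
          gcongr
          exact one_le_pow₀ one_le_two
      _ = _ := by rw [Real.rpow_one]
  have h4 : min 1 (((gridSize d n : ℝ) ^ d) ^ (-β) * √(Real.log δ⁻¹)) ≤
      2 ^ d * min 1 ((n : ℝ) ^ (-β) * √(Real.log δ⁻¹)) := by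
    rw [mul_min_of_nonneg _ _ (by positivity)]
    refine min_le_min ?_ ?_
    · rw [mul_one]
      exact one_le_pow₀ one_le_two
    · rw [← mul_assoc]
      gcongr
  calc _ ≤ (2 * (n : ℝ) ^ (-(1 / (d : ℝ)))) * (2 ^ d * min 1 ((n : ℝ) ^ (-β) * √(Real.log δ⁻¹))) :=
        mul_le_mul h1 h4 (by positivity) (by positivity)
    _ = _ := by
        unfold rate
        ring

lemma rate_pos (d : ℕ) (q : ℝ) {n : ℕ} (hn : 1 ≤ n) {δ : ℝ} (hδ : δ ∈ Ioo (0 : ℝ) 1) :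
    0 < rate d q n δ := by
  have hn0 : (0 : ℝ) < n := by exact_mod_cast hn
  have hlog : 0 < Real.log δ⁻¹ := Real.log_pos ((one_lt_inv₀ hδ.1).2 hδ.2)
  unfold rate
  refine mul_pos (by positivity) (lt_min one_pos (by positivity))

/-! ### The upper bound -/

theorem exists_stratified_isApproximating (d : ℕ) (hd : 1 ≤ d) (p : ℝ≥0∞) (hp : (d : ℝ≥0∞) < p)
    (q : ℝ) (hq : q = (min p 2).toReal) :
    ∃ c : ℝ, 0 < c ∧ ∀ n : ℕ, 1 ≤ n → ∀ δ ∈ Ioo (0 : ℝ) (1 / 2),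
      ∀ (Ω : Type*) [MeasurableSpace Ω] (P : Measure Ω) [IsProbabilityMeasure P]
        (X : (Fin d → Fin (gridSize d n)) → Ω → (Fin d → ℝ)), IsStratifiedSample P X →
        IsApproximating P (stratified X) (sobolevBall d p) (c * rate d q n δ) δ := by
  obtain ⟨A, hA, H⟩ := exists_stratified_bound d hd (lt_finiteExponent hp)
  rw [min_finiteExponent hd p, ← hq] at H
  have hq1 : 1 ≤ q := by
    rw [hq, ← min_finiteExponent hd p]
    have : (1 : ℝ) ≤ d := by exact_mod_cast hd
    exact le_min (this.trans (lt_finiteExponent hp).le) one_le_two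
  refine ⟨A * (2 * 2 ^ d), by positivity, fun n hn δ hδ Ω _ P _ X hX f hf => ?_⟩
  obtain ⟨hfc, g, hg, hnorm⟩ := hf
  have hEq : EqOn f (fun x => f (cubeProj d x)) (cube d) := fun x hx => by
    simp only [cubeProj_of_mem hx]
  have hm := gridSize_pos d hn
  have h1 := H _ g (continuous_comp_cubeProj hfc) (hg.congr hEq)
    (eLpNorm_le_one_of_sobolevNorm_le_one hp hg hnorm) _ hm δ hδ Ω P X hX
  refine le_trans (measure_mono_ae ?_) h1
  filter_upwards [ae_all_iff.2 hX.ae_mem] with ω hω hlt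
  have h2 : integralCube d f = integralCube d (fun x => f (cubeProj d x)) :=
    setIntegral_congr_fun (measurableSet_cube d) hEq
  have h3 : stratified X ω f = stratified X ω (fun x => f (cubeProj d x)) := by
    unfold stratified
    congr 1
    exact Finset.sum_congr rfl fun i _ => hEq (subcube_subset_cube hm i (hω i))
  have hlt' : A * (2 * 2 ^ d) * rate d q n δ < |stratified X ω f - integralCube d f| := hlt
  rw [h2, h3] at hlt'
  refine lt_of_le_of_lt ?_ hlt'
  rw [mul_assoc, mul_assoc A]
  refine mul_le_mul_of_nonneg_left ?_ hA.le
  exact gridSize_rate_le hd hq1 hn δ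

/-! ### Stratified sampling as an algorithm -/

lemma length_collect {d : ℕ} (node : List ℝ → cube d) (f : (Fin d → ℝ) → ℝ) (n : ℕ) :
    (collect node f n).length = n := by
  induction n with
  | zero => rfl
  | succ n ih => simp [collect, ih]

lemma getD_collect {d : ℕ} (node : List ℝ → cube d) (f : (Fin d → ℝ) → ℝ) {n k : ℕ} (hk : k < n) :
    (collect node f n).getD k 0 = f (node (collect node f k)) := by
  induction n with
  | zero => omega
  | succ n ih =>
    rw [collect]
    rcases Nat.lt_succ_iff_lt_or_eq.1 hk with h | h
    · rw [List.getD_append _ _ _ _ (by rwa [length_collect]), ih h]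
    · subst h
      rw [List.getD_append_right _ _ _ _ (by rw [length_collect])]
      simp [length_collect]

section Algorithm

variable (d m : ℕ)

/-- An enumeration of the subcubes. -/
noncomputable def subcubeIndex : (Fin d → Fin m) ≃ Fin (m ^ d) :=
  Fintype.equivFinOfCardEq (by simp)

/-- The sample points of stratified sampling in the order of the enumeration. -/
noncomputable def stratifiedNode (ω : (Fin d → Fin m) → (Fin d → ℝ)) (y : List ℝ) : cube d :=
  -- The length of the history is the number of points already used. Calls beyond `m ^ d` use up the
  -- remaining budget at a fixed point, and the output ignores their values.
  if h : y.length < m ^ d then cubeProj d (ω ((subcubeIndex d m).symm ⟨y.length, h⟩))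
  else cubeProj d 0

/-- The average of the first `m ^ d` function values. -/
noncomputable def stratifiedOutput (y : List ℝ) : ℝ :=
  1 / (m : ℝ) ^ d * ∑ i, y.getD (subcubeIndex d m i) 0

lemma stratifiedOutput_collect {n : ℕ} (hn : m ^ d ≤ n) (ω : (Fin d → Fin m) → (Fin d → ℝ))
    (f : (Fin d → ℝ) → ℝ) :
    stratifiedOutput d m (collect (stratifiedNode d m ω) f n) =
      stratified (fun i ω => (cubeProj d (ω i) : Fin d → ℝ)) ω f := by
  unfold stratifiedOutput stratified
  congr 1
  refine Finset.sum_congr rfl fun i _ => ?_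
  rw [getD_collect _ _ ((subcubeIndex d m i).2.trans_le hn), stratifiedNode,
    dif_pos (by rw [length_collect]; exact (subcubeIndex d m i).2)]
  simp [length_collect]

/-- The joint distribution of the sample points of stratified sampling. -/
noncomputable def stratifiedMeasure : Measure ((Fin d → Fin m) → (Fin d → ℝ)) :=
  Measure.pi fun i => ProbabilityTheory.cond volume (subcube i)

variable {d m}

lemma isProbabilityMeasure_cond_subcube (hm : 0 < m) (i : Fin d → Fin m) :
    IsProbabilityMeasure (ProbabilityTheory.cond volume (subcube i)) := by
  have hm' : (0 : ℝ) < m := by exact_mod_cast hm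
  refine cond_isProbabilityMeasure_of_finite ?_ ?_
  · rw [volume_subcube]
    simp only [ne_eq, ENNReal.ofReal_eq_zero, not_le]
    positivity
  · rw [volume_subcube]
    exact ENNReal.ofReal_ne_top

lemma isProbabilityMeasure_stratifiedMeasure (hm : 0 < m) :
    IsProbabilityMeasure (stratifiedMeasure d m) := by
  have := fun i : Fin d → Fin m => isProbabilityMeasure_cond_subcube hm i
  unfold stratifiedMeasure
  infer_instance

lemma isStratifiedSample_eval (hm : 0 < m) :
    IsStratifiedSample (stratifiedMeasure d m) (fun (i : Fin d → Fin m) ω => ω i) := by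
  have := fun i : Fin d → Fin m => isProbabilityMeasure_cond_subcube hm i
  refine ⟨fun i => measurable_pi_apply i, ?_, fun i => ?_⟩
  · exact iIndepFun_pi (X := fun _ x => x) fun i => aemeasurable_id
  · exact (measurePreserving_eval _ i).map_eq

/-- Stratified sampling on the canonical probability space. -/
noncomputable def stratifiedAlgorithm (hm : 0 < m) {n : ℕ} (hn : m ^ d ≤ n) (p : ℝ≥0∞) :
    MCAlgorithm d n (sobolevSpace d p) where
  Ω := (Fin d → Fin m) → (Fin d → ℝ)
  P := stratifiedMeasure d m
  isProb := isProbabilityMeasure_stratifiedMeasure hm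
  node := stratifiedNode d m
  output _ y := stratifiedOutput d m y
  measurable_error f hf := by
    simp only [stratifiedOutput_collect d m hn]
    have := (continuous_comp_cubeProj hf.1).measurable
    have h1 : ∀ i : Fin d → Fin m, Measurable fun ω : (Fin d → Fin m) → (Fin d → ℝ) =>
      f (cubeProj d (ω i)) := fun i => this.comp (measurable_pi_apply i)
    unfold stratified
    exact (((Finset.measurable_fun_sum _ fun i _ => h1 i).const_mul _).sub_const _).abs

/-- The projection built into the nodes is invisible almost surely, because the sample points lie in
their subcubes. -/
lemma stratifiedAlgorithm_isApproximating (hm : 0 < m) {n : ℕ} (hn : m ^ d ≤ n) (p : ℝ≥0∞)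
    {B : Set ((Fin d → ℝ) → ℝ)} {ε δ : ℝ}
    (h : IsApproximating (stratifiedMeasure d m)
      (stratified fun (i : Fin d → Fin m) ω => ω i) B ε δ) :
    IsApproximating (stratifiedAlgorithm hm hn p).P (stratifiedAlgorithm hm hn p).run B ε δ := by
  intro f hf
  refine le_trans (measure_mono_ae ?_) (h f hf)
  have hae : ∀ᵐ ω ∂(stratifiedMeasure d m), ∀ i, ω i ∈ subcube i :=
    ae_all_iff.2 (isStratifiedSample_eval hm).ae_mem
  filter_upwards [hae] with ω hω hlt
  have h1 : (stratifiedAlgorithm hm hn p).run ω f =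
      stratified (fun (i : Fin d → Fin m) ω => ω i) ω f := by
    refine (stratifiedOutput_collect d m hn ω f).trans ?_
    unfold stratified
    congr 1
    exact Finset.sum_congr rfl fun i _ =>
      congrArg f (cubeProj_of_mem (subcube_subset_cube hm i (hω i)))
  have hlt' : ε < |(stratifiedAlgorithm hm hn p).run ω f - integralCube d f| := hlt
  rw [h1] at hlt'
  exact hlt'

end Algorithm

theorem eProb_asympLE (d : ℕ) (hd : 1 ≤ d) (p : ℝ≥0∞) (hp : (d : ℝ≥0∞) < p)
    (q : ℝ) (hq : q = (min p 2).toReal) :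
    AsympLE (eProb d p) (fun n δ => ENNReal.ofReal (rate d q n δ)) := by
  obtain ⟨c, hc, H⟩ := exists_stratified_isApproximating d hd p hp q hq
  refine ⟨1, 1 / 2, by norm_num, c, hc, fun n hn δ hδ => ?_⟩
  simp only
  rw [← ENNReal.ofReal_mul hc.le]
  have hm := gridSize_pos d hn
  have := isProbabilityMeasure_stratifiedMeasure (d := d) hm
  have hr := rate_pos d q hn (δ := δ) ⟨hδ.1, by linarith [hδ.2]⟩
  exact iInf₂_le (c * rate d q n δ) ⟨by positivity,
    stratifiedAlgorithm hm (gridSize_pow_le hd n) p,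
    stratifiedAlgorithm_isApproximating hm _ p
      (H n hn δ hδ _ _ _ (isStratifiedSample_eval hm))⟩

/-! ### Lower tail bounds for sums of random signs -/

section Signs

variable {ι : Type*} [Fintype ι] [DecidableEq ι]

/-- The sign `±1` belonging to a Boolean. -/
def sgn (b : Bool) : ℝ := if b then 1 else -1

lemma sgn_not (b : Bool) : sgn (!b) = -sgn b := by cases b <;> simp [sgn]

/-- The exponential factorizes over coordinates, so the sum over sign vectors is a product with
factor `2 * cosh l` on `U` and `2` elsewhere. -/
lemma sum_exp_mul_sum_sgn (U : Finset ι) (l : ℝ) :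
    ∑ η : ι → Bool, Real.exp (l * ∑ i ∈ U, sgn (η i)) =
      2 ^ Fintype.card ι * Real.cosh l ^ U.card := by
  have h1 : ∀ η : ι → Bool, Real.exp (l * ∑ i ∈ U, sgn (η i)) =
      ∏ i, if i ∈ U then Real.exp (l * sgn (η i)) else 1 := by
    intro η
    rw [Finset.mul_sum, Real.exp_sum, Finset.prod_ite_mem, Finset.univ_inter]
  have h2 := Finset.prod_univ_sum (fun _ : ι => (Finset.univ : Finset Bool))
    (fun i b => if i ∈ U then Real.exp (l * sgn b) else 1)
  rw [Fintype.piFinset_univ] at h2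
  simp_rw [h1]
  rw [← h2]
  have h3 : ∀ i, ∑ b : Bool, (if i ∈ U then Real.exp (l * sgn b) else 1) =
      2 * if i ∈ U then Real.cosh l else 1 := by
    intro i
    rw [Fintype.sum_bool]
    split_ifs
    · simp only [sgn, if_true, Real.cosh_eq]
      simp
      ring
    · norm_num
  simp_rw [h3]
  rw [Finset.prod_mul_distrib, Finset.prod_const, Finset.card_univ, Finset.prod_ite_mem,
    Finset.univ_inter, Finset.prod_const]

/-- A Paley–Zygmund inequality for finite sums. -/
lemma sq_sum_le_four_mul_card_filter_mul_sum_sq {α : Type*} [Fintype α] {x : α → ℝ} (hx : ∀ i, 0 ≤ x i) {θ : ℝ}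
    (hθ : 2 * (Fintype.card α * θ) ≤ ∑ i, x i) :
    (∑ i, x i) ^ 2 ≤ 4 * ((Finset.univ.filter fun i => θ < x i).card * ∑ i, x i ^ 2) := by
  set G := Finset.univ.filter fun i => θ < x i with hG
  have h1 : ∑ i, x i ≤ 2 * ∑ i ∈ G, x i := by
    have h2 := Finset.sum_filter_add_sum_filter_not Finset.univ (fun i => θ < x i) x
    have h3 : ∑ i ∈ Finset.univ.filter (fun i => ¬ θ < x i), x i ≤ (∑ i, x i) / 2 := by
      by_cases hθ0 : 0 ≤ θ
      · calc ∑ i ∈ Finset.univ.filter (fun i => ¬ θ < x i), x i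
            ≤ (Finset.univ.filter (fun i => ¬ θ < x i)).card • θ :=
              Finset.sum_le_card_nsmul _ _ _ fun i hi => not_lt.1 (Finset.mem_filter.1 hi).2
          _ ≤ Fintype.card α * θ := by
              rw [nsmul_eq_mul]
              gcongr
              exact Finset.card_le_univ _
          _ ≤ _ := by linarith
      · have : Finset.univ.filter (fun i => ¬ θ < x i) = ∅ :=
          Finset.filter_eq_empty_iff.2 fun i _ => not_not.2 ((not_le.1 hθ0).trans_le (hx i))
        rw [this, Finset.sum_empty]
        exact div_nonneg (Finset.sum_nonneg fun i _ => hx i) zero_le_two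
    linarith
  have h4 : (∑ i ∈ G, x i) ^ 2 ≤ G.card * ∑ i ∈ G, x i ^ 2 := sq_sum_le_card_mul_sum_sq
  have h5 : ∑ i ∈ G, x i ^ 2 ≤ ∑ i, x i ^ 2 :=
    Finset.sum_le_sum_of_subset_of_nonneg (Finset.subset_univ _) fun i _ _ => sq_nonneg _
  calc (∑ i, x i) ^ 2 ≤ (2 * ∑ i ∈ G, x i) ^ 2 :=
        pow_le_pow_left₀ (Finset.sum_nonneg fun i _ => hx i) h1 2
    _ = 4 * (∑ i ∈ G, x i) ^ 2 := by ring
    _ ≤ 4 * (G.card * ∑ i ∈ G, x i ^ 2) := by gcongr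
    _ ≤ _ := by gcongr

/-- The half-angle formula gives `cosh l ≥ 1 + l ^ 2 / 2`; with `x = l ^ 2 / 4` it remains to use
`exp x ≤ 1 / (1 - x) ≤ 1 + 2 * x`. -/
lemma exp_sq_div_four_le_cosh {l : ℝ} (hl0 : 0 ≤ l) (hl : l ≤ 1) :
    Real.exp (l ^ 2 / 4) ≤ Real.cosh l := by
  have h1 : 1 + l ^ 2 / 2 ≤ Real.cosh l := by
    have h2 := Real.cosh_sq (l / 2)
    have h3 : Real.cosh l = 1 + 2 * Real.sinh (l / 2) ^ 2 := by
      have := Real.cosh_two_mul (l / 2)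
      rw [mul_div_cancel₀ _ two_ne_zero] at this
      rw [this, h2]
      ring
    have h4 : l / 2 ≤ Real.sinh (l / 2) := Real.self_le_sinh_iff.2 (by positivity)
    have h5 : (l / 2) ^ 2 ≤ Real.sinh (l / 2) ^ 2 := pow_le_pow_left₀ (by positivity) h4 2
    rw [h3]
    linarith
  have hl2 : l ^ 2 ≤ 1 := pow_le_one₀ hl0 hl
  have h6 : Real.exp (l ^ 2 / 4) * (1 - l ^ 2 / 4) ≤ 1 := by
    have h7 := Real.add_one_le_exp (-(l ^ 2 / 4))
    calc Real.exp (l ^ 2 / 4) * (1 - l ^ 2 / 4) ≤ Real.exp (l ^ 2 / 4) * Real.exp (-(l ^ 2 / 4)) := by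
          gcongr
          linarith
      _ = 1 := by rw [← Real.exp_add, add_neg_cancel, Real.exp_zero]
  have h8 : 0 < 1 - l ^ 2 / 4 := by linarith
  refine le_trans ?_ h1
  rw [← le_div_iff₀ h8] at h6
  refine h6.trans ?_
  rw [div_le_iff₀ h8]
  nlinarith [sq_nonneg l]

/-- Paley–Zygmund for `exp (l * S)`, with `S` the sum of the signs over `U`: its mean is `cosh l ^
M` and its second moment `cosh (2 * l) ^ M ≤ exp (2 * l ^ 2 * M)`. Exceeding half the mean forces `S
> M * l / 4 - 1 / l`, and `8 ≤ M * l ^ 2` absorbs the last term. -/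
lemma card_lt_sum_sgn_ge (U : Finset ι) {l : ℝ} (hl0 : 0 < l) (hl : l ≤ 1)
    (hU : 8 ≤ U.card * l ^ 2) :
    (2 : ℝ) ^ Fintype.card ι / 4 * Real.exp (-(2 * l ^ 2 * U.card)) ≤
      (Finset.univ.filter fun η : ι → Bool => U.card * l / 8 < ∑ i ∈ U, sgn (η i)).card := by
  set M := U.card
  set N := Fintype.card ι
  have hch : 1 ≤ Real.cosh l := Real.one_le_cosh l
  have hPZ := sq_sum_le_four_mul_card_filter_mul_sum_sq (x := fun η : ι → Bool =>
    Real.exp (l * ∑ i ∈ U, sgn (η i))) (fun η => (Real.exp_pos _).le) (θ := Real.cosh l ^ M / 2) (by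
      rw [sum_exp_mul_sum_sgn]
      refine le_of_eq ?_
      simp
      ring)
  have hsq : ∀ η : ι → Bool, Real.exp (l * ∑ i ∈ U, sgn (η i)) ^ 2 =
      Real.exp ((2 * l) * ∑ i ∈ U, sgn (η i)) := by
    intro η
    rw [← Real.exp_nat_mul]
    congr 1
    push_cast
    ring
  simp_rw [hsq] at hPZ
  rw [sum_exp_mul_sum_sgn, sum_exp_mul_sum_sgn] at hPZ
  set G := Finset.univ.filter fun η : ι → Bool =>
    Real.cosh l ^ M / 2 < Real.exp (l * ∑ i ∈ U, sgn (η i)) with hG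
  have hsub : G ⊆ Finset.univ.filter fun η : ι → Bool => M * l / 8 < ∑ i ∈ U, sgn (η i) := by
    intro η hη
    rw [hG, Finset.mem_filter] at hη
    rw [Finset.mem_filter]
    refine ⟨Finset.mem_univ _, ?_⟩
    have h1 : Real.exp (M * (l ^ 2 / 4)) ≤ Real.cosh l ^ M := by
      rw [Real.exp_nat_mul]
      exact pow_le_pow_left₀ (Real.exp_pos _).le (exp_sq_div_four_le_cosh hl0.le hl) M
    have h2 : Real.exp (M * (l ^ 2 / 4) - 1) < Real.exp (l * ∑ i ∈ U, sgn (η i)) := by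
      refine lt_of_le_of_lt ?_ hη.2
      rw [Real.exp_sub, div_le_div_iff₀ (Real.exp_pos _) two_pos]
      have h3 := Real.add_one_le_exp (1 : ℝ)
      have h4 : 0 ≤ Real.cosh l ^ M := by positivity
      nlinarith [Real.exp_pos (M * (l ^ 2 / 4))]
    rw [Real.exp_lt_exp] at h2
    by_contra hcon
    rw [not_lt] at hcon
    have h5 := mul_le_mul_of_nonneg_left hcon hl0.le
    nlinarith
  have hcard : (G.card : ℝ) ≤
      (Finset.univ.filter fun η : ι → Bool => M * l / 8 < ∑ i ∈ U, sgn (η i)).card := by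
    exact_mod_cast Finset.card_le_card hsub
  refine le_trans ?_ hcard
  have h6 : Real.cosh (2 * l) ^ M ≤ Real.exp (2 * l ^ 2 * M) := by
    calc Real.cosh (2 * l) ^ M ≤ Real.exp ((2 * l) ^ 2 / 2) ^ M :=
          pow_le_pow_left₀ (Real.cosh_pos _).le (Real.cosh_le_exp_half_sq _) M
      _ = _ := by
          rw [← Real.exp_nat_mul]
          congr 1
          ring
  have h7 : ((2 : ℝ) ^ N) ^ 2 ≤ 4 * (G.card * (2 ^ N * Real.exp (2 * l ^ 2 * M))) := by
    calc ((2 : ℝ) ^ N) ^ 2 ≤ (2 ^ N * Real.cosh l ^ M) ^ 2 := by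
          refine pow_le_pow_left₀ (by positivity) ?_ 2
          exact le_mul_of_one_le_right (by positivity) (one_le_pow₀ hch)
      _ ≤ 4 * (G.card * (2 ^ N * Real.cosh (2 * l) ^ M)) := hPZ
      _ ≤ _ := by gcongr
  have h8 : (2 : ℝ) ^ N ≤ 4 * (G.card * Real.exp (2 * l ^ 2 * M)) := by
    have h9 : (0 : ℝ) < 2 ^ N := by positivity
    refine le_of_mul_le_mul_left ?_ h9
    linarith
  rw [Real.exp_neg, ← div_eq_mul_inv, div_le_iff₀ (Real.exp_pos _)]
  linarith

/-- A shift `r ≥ 0` only helps the upper tail; for `r ≤ 0` flip all signs. The shift will stand for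
the algorithm's guess. -/
lemma card_lt_abs_add_sum_sgn_ge (U : Finset ι) {l : ℝ} (hl0 : 0 < l) (hl : l ≤ 1)
    (hU : 8 ≤ U.card * l ^ 2) (r : ℝ) :
    (2 : ℝ) ^ Fintype.card ι / 4 * Real.exp (-(2 * l ^ 2 * U.card)) ≤
      (Finset.univ.filter fun η : ι → Bool => U.card * l / 8 < |r + ∑ i ∈ U, sgn (η i)|).card := by
  refine (card_lt_sum_sgn_ge U hl0 hl hU).trans (Nat.cast_le.2 ?_)
  rcases le_total 0 r with hr | hr
  · refine Finset.card_le_card fun η hη => ?_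
    rw [Finset.mem_filter] at hη ⊢
    refine ⟨hη.1, hη.2.trans_le (le_trans ?_ (le_abs_self _))⟩
    linarith
  · refine Finset.card_le_card_of_injOn (fun η i => !η i) (fun η hη => ?_) ?_
    · rw [Finset.mem_coe, Finset.mem_filter] at hη ⊢
      refine ⟨Finset.mem_univ _, hη.2.trans_le (le_trans ?_ (neg_le_abs _))⟩
      simp_rw [sgn_not]
      rw [Finset.sum_neg_distrib]
      linarith
    · intro η _ η' _ h
      ext i
      have := congrFun h i
      simpa using this

/-- If the set `J ε` of revealed coordinates is determined by the values of `ε` on `J ε`, then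
re-randomizing the other coordinates does not change the proportion of the sign vectors with a given
property. -/
lemma le_card_filter_of_forall_piecewise {J : (ι → Bool) → Finset ι}
    (hJ : ∀ ε ε' : ι → Bool, (∀ i ∈ J ε, ε' i = ε i) → J ε' = J ε)
    {F : (ι → Bool) → Prop} [DecidablePred F] {r : ℝ}
    (h : ∀ ε, r ≤ (Finset.univ.filter fun η => F ((J ε).piecewise ε η)).card) :
    r ≤ (Finset.univ.filter F).card := by
  -- `T` exchanges the two sign vectors off `J z.1`. The hypothesis says that this leaves the
  -- revealed set unchanged, so `T` is an involution, and counting pairs before and after `T` gives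
  -- the claim.
  set T : (ι → Bool) × (ι → Bool) → (ι → Bool) × (ι → Bool) := fun z =>
    ((J z.1).piecewise z.1 z.2, (J z.1).piecewise z.2 z.1) with hT
  have hinv : Function.Involutive T := by
    rintro ⟨ε, η⟩
    have h1 : J ((J ε).piecewise ε η) = J ε :=
      hJ _ _ fun i hi => Finset.piecewise_eq_of_mem _ _ _ hi
    have h2 : ∀ ξ ζ : ι → Bool, (J ((J ε).piecewise ε η)).piecewise ξ ζ = (J ε).piecewise ξ ζ :=
      fun ξ ζ => by ext i; simp only [Finset.piecewise, h1]
    simp only [hT, h2]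
    ext i <;> by_cases hi : i ∈ J ε <;> simp [hi]
  have h2 : ∑ z : (ι → Bool) × (ι → Bool), (if F z.1 then (1 : ℝ) else 0) =
      ∑ z : (ι → Bool) × (ι → Bool), (if F ((J z.1).piecewise z.1 z.2) then (1 : ℝ) else 0) :=
    (Equiv.sum_comp (hinv.toPerm T) fun z => if F z.1 then (1 : ℝ) else 0).symm
  rw [Fintype.sum_prod_type_right, Fintype.sum_prod_type] at h2
  simp only [Finset.sum_const, nsmul_eq_mul, Finset.sum_boole] at h2
  have h3 : (Fintype.card (ι → Bool) : ℝ) * r ≤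
      ∑ ε, ((Finset.univ.filter fun η => F ((J ε).piecewise ε η)).card : ℝ) := by
    rw [← Finset.card_univ, ← nsmul_eq_mul]
    exact Finset.card_nsmul_le_sum _ _ _ fun ε _ => h ε
  rw [← h2, Finset.card_univ] at h3
  exact le_of_mul_le_mul_left h3 (by exact_mod_cast Fintype.card_pos)

end Signs

/-! ### The lower bound for algorithms on a family of bump functions -/

section Adaptive

variable {ι : Type*} [Fintype ι] [DecidableEq ι] {d : ℕ}

/-- The combination of the functions `ψ i` with random signs. -/
def signedSum (ψ : ι → (Fin d → ℝ) → ℝ) (ε : ι → Bool) (x : Fin d → ℝ) : ℝ :=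
  ∑ i, sgn (ε i) * ψ i x

open Classical in
/-- The indices whose function is non-zero at one of the first `n` sample points. -/
noncomputable def touched (ψ : ι → (Fin d → ℝ) → ℝ) (node : List ℝ → cube d) (n : ℕ)
    (ε : ι → Bool) : Finset ι :=
  (Finset.range n).biUnion fun l =>
    Finset.univ.filter fun i => ψ i (node (collect node (signedSum ψ ε) l)) ≠ 0

lemma card_touched_le {ψ : ι → (Fin d → ℝ) → ℝ}
    (hψ : ∀ x i j, ψ i x ≠ 0 → ψ j x ≠ 0 → i = j) (node : List ℝ → cube d) (n : ℕ)
    (ε : ι → Bool) : (touched ψ node n ε).card ≤ n := by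
  classical
  refine (Finset.card_biUnion_le_card_mul _ _ 1 fun l _ => ?_).trans (by simp)
  refine Finset.card_le_one.2 fun i hi j hj => ?_
  exact hψ _ i j (Finset.mem_filter.1 hi).2 (Finset.mem_filter.1 hj).2

/-- Induction along the run: equal histories give the same next node, and there every bump with a
sign outside the touched set vanishes. -/
lemma collect_congr_of_eqOn_touched {ψ : ι → (Fin d → ℝ) → ℝ} {node : List ℝ → cube d} {n : ℕ}
    {ε ε' : ι → Bool} (h : ∀ i ∈ touched ψ node n ε, ε' i = ε i) {l : ℕ} (hl : l ≤ n) :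
    collect node (signedSum ψ ε') l = collect node (signedSum ψ ε) l := by
  induction l with
  | zero => rfl
  | succ l ih =>
    have ih' := ih (by omega)
    rw [collect, collect, ih']
    congr 2
    refine Finset.sum_congr rfl fun i _ => ?_
    by_cases hi : ψ i (node (collect node (signedSum ψ ε) l)) = 0
    · rw [hi, mul_zero, mul_zero]
    · rw [h i]
      exact Finset.mem_biUnion.2 ⟨l, Finset.mem_range.2 (by omega),
        Finset.mem_filter.2 ⟨Finset.mem_univ _, hi⟩⟩

lemma touched_congr {ψ : ι → (Fin d → ℝ) → ℝ} {node : List ℝ → cube d} {n : ℕ}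
    {ε ε' : ι → Bool} (h : ∀ i ∈ touched ψ node n ε, ε' i = ε i) :
    touched ψ node n ε' = touched ψ node n ε := by
  unfold touched
  refine Finset.biUnion_congr rfl fun l hl => ?_
  rw [collect_congr_of_eqOn_touched h (Finset.mem_range.1 hl).le]

/-- Fix the revealed signs: the output `y` is then constant, while the at least `card ι - n` hidden
signs are free. The error is `I` times the modulus of their sum shifted by `b - y / I`. -/
lemma card_fail_ge {ψ : ι → (Fin d → ℝ) → ℝ}
    (hψ : ∀ x i j, ψ i x ≠ 0 → ψ j x ≠ 0 → i = j) (node : List ℝ → cube d)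
    (output : List ℝ → ℝ) {n : ℕ} {I e l : ℝ} (hI : 0 < I)
    (hl0 : 0 < l) (hl : l ≤ 1) (hU : 8 ≤ ((Fintype.card ι : ℝ) - n) * l ^ 2)
    (he : e ≤ I * (((Fintype.card ι : ℝ) - n) * l / 8)) :
    (2 : ℝ) ^ Fintype.card ι / 4 * Real.exp (-(2 * l ^ 2 * Fintype.card ι)) ≤
      (Finset.univ.filter fun ε : ι → Bool =>
        e < |output (collect node (signedSum ψ ε) n) - I * ∑ i, sgn (ε i)|).card := by
  refine le_card_filter_of_forall_piecewise (J := touched ψ node n)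
    (fun ε ε' h => touched_congr h) fun ε => ?_
  set J := touched ψ node n ε with hJ
  have hJn : J.card ≤ n := card_touched_le hψ node n ε
  have hcard : (Jᶜ.card : ℝ) = Fintype.card ι - J.card := by
    rw [Finset.card_compl, Nat.cast_sub (Finset.card_le_univ J)]
  have hM : (Fintype.card ι : ℝ) - n ≤ Jᶜ.card := by
    rw [hcard]
    have : (J.card : ℝ) ≤ n := by exact_mod_cast hJn
    linarith
  have hM' : (Jᶜ.card : ℝ) ≤ Fintype.card ι := by exact_mod_cast Finset.card_le_univ _
  set y := output (collect node (signedSum ψ ε) n) with hy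
  set b := ∑ i ∈ J, sgn (ε i) with hb
  have h1 := card_lt_abs_add_sum_sgn_ge Jᶜ hl0 hl
    (hU.trans (mul_le_mul_of_nonneg_right hM (sq_nonneg l))) (b - y / I)
  refine le_trans ?_ (h1.trans (Nat.cast_le.2 (Finset.card_le_card fun η hη => ?_)))
  · gcongr
  · rw [Finset.mem_filter] at hη ⊢
    refine ⟨Finset.mem_univ _, ?_⟩
    have h2 : ∀ i ∈ J, (J.piecewise ε η) i = ε i := fun i hi =>
      Finset.piecewise_eq_of_mem _ _ _ hi
    rw [collect_congr_of_eqOn_touched h2 le_rfl, ← hy]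
    have h3 : ∑ i, sgn ((J.piecewise ε η) i) = b + ∑ i ∈ Jᶜ, sgn (η i) := by
      rw [← Finset.sum_add_sum_compl J]
      congr 1
      · exact Finset.sum_congr rfl fun i hi => by rw [h2 i hi]
      · exact Finset.sum_congr rfl fun i hi => by
          rw [Finset.piecewise_eq_of_notMem _ _ _ (Finset.mem_compl.1 hi)]
    rw [h3]
    have h4 : |y - I * (b + ∑ i ∈ Jᶜ, sgn (η i))| =
        I * |b - y / I + ∑ i ∈ Jᶜ, sgn (η i)| := by
      rw [abs_sub_comm, ← abs_of_pos hI, ← abs_mul, abs_of_pos hI]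
      congr 1
      field_simp
      ring
    rw [h4]
    refine he.trans_lt ?_
    refine mul_lt_mul_of_pos_left (lt_of_le_of_lt ?_ hη.2) hI
    gcongr

/-- If `e` were smaller, then for every `ω` a proportion of sign vectors greater than `δ` would
fail. Integrating over `ω` and exchanging sum and integral contradicts failure probability at most
`δ` for each sign vector. -/
theorem lt_of_isApproximating {p : ℝ≥0∞} {ψ : ι → (Fin d → ℝ) → ℝ}
    (hψ : ∀ x i j, ψ i x ≠ 0 → ψ j x ≠ 0 → i = j) {I : ℝ} (hI : 0 < I)
    (hint : ∀ ε, integralCube d (signedSum ψ ε) = I * ∑ i, sgn (ε i))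
    (hspace : ∀ ε, signedSum ψ ε ∈ sobolevSpace d p)
    (hball : ∀ ε, signedSum ψ ε ∈ sobolevBall d p)
    {n : ℕ} (A : MCAlgorithm d n (sobolevSpace d p)) {e δ l : ℝ}
    (hA : IsApproximating A.P A.run (sobolevBall d p) e δ) (hδ0 : 0 ≤ δ)
    (hl0 : 0 < l) (hl : l ≤ 1) (hU : 8 ≤ ((Fintype.card ι : ℝ) - n) * l ^ 2)
    (hδ : δ < Real.exp (-(2 * l ^ 2 * Fintype.card ι)) / 4) :
    I * (((Fintype.card ι : ℝ) - n) * l / 8) < e := by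
  classical
  by_contra! he
  set E : (ι → Bool) → Set A.Ω := fun ε =>
    {ω | e < |A.run ω (signedSum ψ ε) - integralCube d (signedSum ψ ε)|} with hE
  have hEm : ∀ ε, MeasurableSet (E ε) := fun ε =>
    measurableSet_lt measurable_const (A.measurable_error _ (hspace ε))
  set r := (2 : ℝ) ^ Fintype.card ι / 4 * Real.exp (-(2 * l ^ 2 * Fintype.card ι)) with hr
  have h1 : ∀ ω, ENNReal.ofReal r ≤ ∑ ε, (E ε).indicator 1 ω := by
    intro ω
    have h2 := card_fail_ge hψ (A.node ω) (A.output ω) hI hl0 hl hU he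
    refine (ENNReal.ofReal_le_ofReal h2).trans (le_of_eq ?_)
    rw [ENNReal.ofReal_natCast, Finset.card_filter]
    push_cast
    refine Finset.sum_congr rfl fun ε _ => ?_
    rw [← hint, Set.indicator_apply]
    rfl
  have h3 : ENNReal.ofReal r ≤ ∑ ε, A.P (E ε) := by
    calc ENNReal.ofReal r = ∫⁻ _, ENNReal.ofReal r ∂A.P := by simp
      _ ≤ ∫⁻ ω, ∑ ε, (E ε).indicator 1 ω ∂A.P := lintegral_mono h1
      _ = ∑ ε, A.P (E ε) := by
        rw [lintegral_finsetSum _ fun ε _ => measurable_one.indicator (hEm ε)]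
        exact Finset.sum_congr rfl fun ε _ => lintegral_indicator_one (hEm ε)
  have h4 : ∑ ε, A.P (E ε) ≤ ENNReal.ofReal (2 ^ Fintype.card ι * δ) := by
    calc ∑ ε, A.P (E ε) ≤ ∑ _ε : ι → Bool, ENNReal.ofReal δ :=
          Finset.sum_le_sum fun ε _ => hA _ (hball ε)
      _ = _ := by
        rw [Finset.sum_const, Finset.card_univ, Fintype.card_fun, Fintype.card_bool, nsmul_eq_mul,
          ENNReal.ofReal_mul (by positivity)]
        congr 1
        rw [← ENNReal.ofReal_natCast]
        push_cast
        rfl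
  have h5 := (ENNReal.ofReal_le_ofReal_iff (by positivity)).1 (h3.trans h4)
  have h6 : (0 : ℝ) < 2 ^ Fintype.card ι := by positivity
  have h7 := mul_lt_mul_of_pos_left hδ h6
  rw [hr] at h5
  linarith

end Adaptive

/-! ### Smooth functions in the Sobolev ball -/

lemma isWeakGradient_fderiv {d : ℕ} {f : (Fin d → ℝ) → ℝ} (hf : ContDiff ℝ 1 f) :
    IsWeakGradient f fun j x => fderiv ℝ f x (Pi.single j 1) := by
  intro j
  have hc : Continuous fun x => fderiv ℝ f x (Pi.single j 1) :=
    (hf.continuous_fderiv one_ne_zero).clm_apply continuous_const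
  refine ⟨hc.locallyIntegrable.locallyIntegrableOn _, fun φ hφ hcs hsupp => ?_⟩
  have hφ' : Continuous fun x => fderiv ℝ φ x (Pi.single j 1) :=
    (hφ.continuous_fderiv (by simp)).clm_apply continuous_const
  have hcs' : HasCompactSupport fun x => fderiv ℝ φ x (Pi.single j 1) := hcs.fderiv_apply ℝ _
  have h0 : ∀ x ∉ cube d, φ x = 0 := fun x hx =>
    image_eq_zero_of_notMem_tsupport fun h => hx (interior_subset (hsupp h))
  have h1 : ∀ x ∉ cube d, fderiv ℝ φ x = 0 := fun x hx => by
    by_contra h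
    exact hx (interior_subset (hsupp (support_fderiv_subset ℝ h)))
  rw [setIntegral_eq_integral_of_forall_compl_eq_zero fun x hx => by rw [h1 x hx]; simp,
    setIntegral_eq_integral_of_forall_compl_eq_zero fun x hx => by rw [h0 x hx, mul_zero]]
  refine integral_mul_fderiv_eq_neg_fderiv_mul_of_integrable ?_ ?_ ?_ ?_ ?_
  · exact (hc.mul hφ.continuous).integrable_of_hasCompactSupport hcs.mul_left
  · exact (hf.continuous.mul hφ').integrable_of_hasCompactSupport hcs'.mul_left
  · exact (hf.continuous.mul hφ.continuous).integrable_of_hasCompactSupport hcs.mul_left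
  · exact fun x _ => hf.differentiable one_ne_zero x
  · exact fun x _ => hφ.differentiable (by simp) x

/-- The cube has measure one, so each of the `d + 1` terms of the norm contributes at most `(1 / (d
+ 1)) ^ p ≤ 1 / (d + 1)`. -/
lemma mem_sobolevBall_of_contDiff {d : ℕ} {p : ℝ≥0∞} (hp : 1 ≤ p) {f : (Fin d → ℝ) → ℝ}
    (hf : ContDiff ℝ 1 f) (h0 : ∀ x, |f x| ≤ 1 / (d + 1))
    (h1 : ∀ x j, |fderiv ℝ f x (Pi.single j 1)| ≤ 1 / (d + 1)) : f ∈ sobolevBall d p := by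
  refine ⟨hf.continuous.continuousOn, _, isWeakGradient_fderiv hf, ?_⟩
  have hC : ENNReal.ofReal (1 / (d + 1)) ≤ 1 := by
    rw [ENNReal.ofReal_le_one, div_le_one (by positivity)]
    linarith [Nat.cast_nonneg (α := ℝ) d]
  have hb : ∀ (u : (Fin d → ℝ) → ℝ), (∀ x, |u x| ≤ 1 / (d + 1)) →
      eLpNorm u p (volume.restrict (cube d)) ≤ ENNReal.ofReal (1 / (d + 1)) := by
    intro u hu
    have := eLpNorm_le_of_ae_bound (p := p) (μ := volume.restrict (cube d)) (f := u)
      (C := 1 / (d + 1)) (Filter.Eventually.of_forall hu)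
    simpa using this
  unfold sobolevNorm
  split_ifs with hpt
  · subst hpt
    exact max_le ((hb f h0).trans hC) (iSup_le fun j => (hb _ fun x => h1 x j).trans hC)
  · have hp1 : 1 ≤ p.toReal := by
      rw [← ENNReal.toReal_one]
      exact ENNReal.toReal_mono hpt hp
    have hpow : ∀ (u : (Fin d → ℝ) → ℝ), (∀ x, |u x| ≤ 1 / (d + 1)) →
        eLpNorm u p (volume.restrict (cube d)) ^ p.toReal ≤ ENNReal.ofReal (1 / (d + 1)) :=
      fun u hu => (ENNReal.rpow_le_rpow (hb u hu) (by linarith)).trans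
        (ENNReal.rpow_le_self_of_le_one hC hp1)
    refine ENNReal.rpow_le_one ?_ (by positivity)
    calc _ ≤ ENNReal.ofReal (1 / (d + 1)) + ∑ _j : Fin d, ENNReal.ofReal (1 / (d + 1)) :=
          add_le_add (hpow f h0) (Finset.sum_le_sum fun j _ => hpow _ fun x => h1 x j)
      _ = ENNReal.ofReal ((d + 1) * (1 / (d + 1))) := by
          rw [ENNReal.ofReal_mul (by positivity), ENNReal.ofReal_add (by positivity) zero_le_one]
          simp
          ring
      _ = 1 := by
          rw [mul_one_div_cancel (by positivity), ENNReal.ofReal_one]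
      _ ≤ 1 := le_rfl

/-! ### The family of bump functions -/

lemma abs_sum_le_of_subsingleton_support {ι : Type*} [Fintype ι] {a : ι → ℝ} {C : ℝ} (hC : 0 ≤ C)
    (h : ∀ i j, a i ≠ 0 → a j ≠ 0 → i = j) (ha : ∀ i, |a i| ≤ C) : |∑ i, a i| ≤ C := by
  by_cases h0 : ∃ i, a i ≠ 0
  · obtain ⟨i, hi⟩ := h0
    rw [Finset.sum_eq_single i (fun j _ hj => by_contra fun h' => hj (h j i h' hi))
      (fun h' => absurd (Finset.mem_univ i) h')]
    exact ha i
  · push Not at h0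
    simpa [h0] using hC

section Bumps

variable {d k : ℕ}

/-- The map that takes the subcube with index `i` to the unit cube. -/
def zoom (i : Fin d → Fin k) (x : Fin d → ℝ) : Fin d → ℝ := (k : ℝ) • x - fun j => ((i j : ℕ) : ℝ)

lemma eq_of_zoom_mem_interior {i i' : Fin d → Fin k} {x : Fin d → ℝ}
    (h : zoom i x ∈ interior (cube d)) (h' : zoom i' x ∈ interior (cube d)) : i = i' := by
  rw [mem_interior_cube] at h h'
  ext j
  have h1 := h j
  have h2 := h' j
  simp only [zoom, Pi.sub_apply, Pi.smul_apply, smul_eq_mul] at h1 h2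
  have h3 : ((i j : ℕ) : ℝ) < ((i' j : ℕ) : ℝ) + 1 := by linarith
  have h4 : ((i' j : ℕ) : ℝ) < ((i j : ℕ) : ℝ) + 1 := by linarith
  have h5 : (i j : ℕ) < (i' j : ℕ) + 1 := by exact_mod_cast h3
  have h6 : (i' j : ℕ) < (i j : ℕ) + 1 := by exact_mod_cast h4
  omega

lemma mem_cube_of_zoom_mem_interior (hk : 0 < k) {i : Fin d → Fin k} {x : Fin d → ℝ}
    (h : zoom i x ∈ interior (cube d)) : x ∈ cube d := by
  have hk' : (0 : ℝ) < k := by exact_mod_cast hk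
  rw [mem_interior_cube] at h
  refine mem_cube.2 fun j => ?_
  have h1 := h j
  simp only [zoom, Pi.sub_apply, Pi.smul_apply, smul_eq_mul] at h1
  have h2 : ((i j : ℕ) : ℝ) + 1 ≤ k := by exact_mod_cast (i j).2
  have h3 : (0 : ℝ) ≤ ((i j : ℕ) : ℝ) := Nat.cast_nonneg _
  constructor
  · by_contra! h4
    nlinarith
  · by_contra! h4
    nlinarith

lemma hasFDerivAt_zoom (i : Fin d → Fin k) (x : Fin d → ℝ) :
    HasFDerivAt (zoom i) ((k : ℝ) • ContinuousLinearMap.id ℝ (Fin d → ℝ)) x :=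
  ((hasFDerivAt_id x).const_smul (k : ℝ)).sub_const _

lemma contDiff_zoom (i : Fin d → Fin k) {n : WithTop ℕ∞} : ContDiff ℝ n (zoom i) := by
  unfold zoom
  fun_prop

/-- The bump `φ`, transplanted to the subcube with index `i` and scaled to slope of order `κ`. -/
noncomputable def bump (φ : (Fin d → ℝ) → ℝ) (κ : ℝ) (i : Fin d → Fin k) (x : Fin d → ℝ) : ℝ :=
  κ / k * φ (zoom i x)

variable {φ : (Fin d → ℝ) → ℝ}

lemma zoom_mem_of_bump_ne_zero (hφs : tsupport φ ⊆ interior (cube d)) {κ : ℝ}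
    {i : Fin d → Fin k} {x : Fin d → ℝ} (h : bump φ κ i x ≠ 0) : zoom i x ∈ interior (cube d) :=
  hφs (subset_tsupport φ (right_ne_zero_of_mul h))

lemma contDiff_bump {n : WithTop ℕ∞} (hφ : ContDiff ℝ n φ) (κ : ℝ) (i : Fin d → Fin k) :
    ContDiff ℝ n (bump φ κ i) :=
  contDiff_const.mul (hφ.comp (contDiff_zoom i))

lemma fderiv_bump (hk : 0 < k) (hφ : Differentiable ℝ φ) (κ : ℝ) (i : Fin d → Fin k)
    (x v : Fin d → ℝ) : fderiv ℝ (bump φ κ i) x v = κ * fderiv ℝ φ (zoom i x) v := by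
  have hk' : (0 : ℝ) < k := by exact_mod_cast hk
  have h1 := ((hφ (zoom i x)).hasFDerivAt.comp x (hasFDerivAt_zoom i x)).const_mul (κ / k)
  have h2 : fderiv ℝ (bump φ κ i) x = _ := h1.fderiv
  rw [h2]
  simp only [FunLike.coe_smul, Pi.smul_apply, ContinuousLinearMap.comp_apply,
    ContinuousLinearMap.id_apply, smul_eq_mul, map_smul]
  field_simp

lemma integral_bump (hk : 0 < k) (hφs : tsupport φ ⊆ interior (cube d)) (κ : ℝ)
    (i : Fin d → Fin k) : ∫ x in cube d, bump φ κ i x = κ / k * ((k : ℝ) ^ d)⁻¹ * ∫ x, φ x := by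
  have hk' : (0 : ℝ) < k := by exact_mod_cast hk
  rw [setIntegral_eq_integral_of_forall_compl_eq_zero fun x hx => by
    by_contra h
    exact hx (mem_cube_of_zoom_mem_interior hk (zoom_mem_of_bump_ne_zero hφs h))]
  unfold bump
  rw [integral_const_mul, mul_assoc]
  congr 1
  have h1 := Measure.integral_comp_smul (volume : Measure (Fin d → ℝ))
    (fun y => φ (y - fun j => ((i j : ℕ) : ℝ))) k
  rw [integral_sub_right_eq_self] at h1
  rw [Module.finrank_fin_fun, abs_of_pos (by positivity), smul_eq_mul] at h1
  exact h1

lemma integralCube_signedSum_bump (hk : 0 < k) (hφ : Continuous φ)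
    (hφs : tsupport φ ⊆ interior (cube d)) (κ : ℝ) (ε : (Fin d → Fin k) → Bool) :
    integralCube d (signedSum (bump φ κ) ε) =
      (κ / k * ((k : ℝ) ^ d)⁻¹ * ∫ x, φ x) * ∑ i, sgn (ε i) := by
  unfold integralCube signedSum
  rw [integral_finsetSum]
  · simp_rw [integral_const_mul, integral_bump hk hφs]
    rw [← Finset.sum_mul, mul_comm]
  · intro i _
    have : Continuous (bump φ κ i) :=
      continuous_const.mul (hφ.comp (contDiff_zoom i (n := 0)).continuous)
    exact (continuous_const.mul this).continuousOn.integrableOn_compact (isCompact_cube d)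

lemma abs_sgn (b : Bool) : |sgn b| = 1 := by cases b <;> simp [sgn]

/-- The height `κ / k` compensates the factor `k` from zooming, so gradients are bounded
independently of `k`; supports are disjoint, so at each point only one bump matters. `D + 1` in
place of `D` covers the bound on the values too. -/
lemma signedSum_bump_mem_sobolevBall {p : ℝ≥0∞} (hp : 1 ≤ p) (hk : 0 < k)
    (hφ : ContDiff ℝ 1 φ) (hφs : tsupport φ ⊆ interior (cube d)) (hφ0 : ∀ x, 0 ≤ φ x)
    (hφ1 : ∀ x, φ x ≤ 1) {D : ℝ} (hD0 : 0 ≤ D) (hD : ∀ x, ‖fderiv ℝ φ x‖ ≤ D)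
    (ε : (Fin d → Fin k) → Bool) :
    signedSum (bump φ (1 / ((d + 1) * (D + 1)))) ε ∈ sobolevBall d p := by
  have hk1 : (1 : ℝ) ≤ k := by exact_mod_cast hk
  set κ : ℝ := 1 / ((d + 1) * (D + 1)) with hκ
  have hκ0 : 0 < κ := by positivity
  have hκD : κ * (D + 1) = 1 / (d + 1) := by
    rw [hκ]
    field_simp
  have hdiff := hφ.differentiable one_ne_zero
  have hcd : ∀ i, ContDiff ℝ 1 fun x => sgn (ε i) * bump φ κ i x := fun i =>
    contDiff_const.mul (contDiff_bump hφ κ i)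
  refine mem_sobolevBall_of_contDiff hp (ContDiff.sum fun i _ => hcd i) (fun x => ?_) fun x j => ?_
  · refine abs_sum_le_of_subsingleton_support (by positivity) (fun i i' h h' => ?_) fun i => ?_
    · exact eq_of_zoom_mem_interior (zoom_mem_of_bump_ne_zero hφs (right_ne_zero_of_mul h))
        (zoom_mem_of_bump_ne_zero hφs (right_ne_zero_of_mul h'))
    · rw [abs_mul, abs_sgn, one_mul, bump, abs_mul, abs_of_nonneg (hφ0 _),
        abs_of_pos (by positivity)]
      calc κ / k * φ (zoom i x) ≤ κ / 1 * 1 := by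
            gcongr
            · exact hφ0 _
            · exact hφ1 _
        _ ≤ κ * (D + 1) := by
            rw [div_one]
            gcongr
            linarith
        _ = _ := hκD
  · have h1 : fderiv ℝ (signedSum (bump φ κ) ε) x (Pi.single j 1) =
        ∑ i, sgn (ε i) * (κ * fderiv ℝ φ (zoom i x) (Pi.single j 1)) := by
      have h2 : HasFDerivAt (signedSum (bump φ κ) ε)
          (∑ i, sgn (ε i) • fderiv ℝ (bump φ κ i) x) x := by
        refine HasFDerivAt.fun_sum fun i _ => ?_
        exact ((contDiff_bump hφ κ i).differentiable one_ne_zero x).hasFDerivAt.const_mul _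
      rw [h2.fderiv]
      simp [fderiv_bump hk hdiff]
    rw [h1]
    have hmem : ∀ i, sgn (ε i) * (κ * fderiv ℝ φ (zoom i x) (Pi.single j 1)) ≠ 0 →
        zoom i x ∈ interior (cube d) := fun i h => by
      refine hφs (support_fderiv_subset ℝ fun h' => h ?_)
      rw [h']
      simp
    refine abs_sum_le_of_subsingleton_support (by positivity)
      (fun i i' h h' => eq_of_zoom_mem_interior (hmem i h) (hmem i' h')) fun i => ?_
    rw [abs_mul, abs_sgn, one_mul, abs_mul, abs_of_pos hκ0, ← hκD]
    gcongr
    have h3 := (fderiv ℝ φ (zoom i x)).le_opNorm (Pi.single j 1)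
    have h4 : ‖(Pi.single j 1 : Fin d → ℝ)‖ = 1 := by rw [Pi.norm_single, norm_one]
    rw [h4, mul_one, Real.norm_eq_abs] at h3
    linarith [hD (zoom i x)]

lemma mem_sobolevSpace_of_mem_sobolevBall {d : ℕ} {p : ℝ≥0∞} {f : (Fin d → ℝ) → ℝ}
    (hf : f ∈ sobolevBall d p) : f ∈ sobolevSpace d p := by
  obtain ⟨h1, g, h2, h3⟩ := hf
  exact ⟨h1, g, h2, h3.trans_lt ENNReal.one_lt_top⟩

end Bumps

/-- A lower bound for the error of any algorithm in terms of the number of subcubes. -/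
theorem exists_error_lower_bound (d : ℕ) {p : ℝ≥0∞} (hp : 1 ≤ p) :
    ∃ κ : ℝ, 0 < κ ∧ ∀ k n : ℕ, 0 < k → ∀ (A : MCAlgorithm d n (sobolevSpace d p)) (e δ l : ℝ),
      IsApproximating A.P A.run (sobolevBall d p) e δ → 0 ≤ δ → 0 < l → l ≤ 1 →
      8 ≤ ((k : ℝ) ^ d - n) * l ^ 2 → δ < Real.exp (-(2 * l ^ 2 * (k : ℝ) ^ d)) / 4 →
      κ * ((k : ℝ) ^ d - n) * l / (k * (k : ℝ) ^ d) < e := by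
  obtain ⟨φ, hφ, hφc, hφs, hφ0, hφ1, hI⟩ := exists_bump d
  have hφ' : ContDiff ℝ 1 φ := hφ.of_le (by exact_mod_cast le_top)
  obtain ⟨D, hD⟩ := (hφc.fderiv ℝ).exists_bound_of_continuous (hφ'.continuous_fderiv one_ne_zero)
  have hD0 : 0 ≤ D := (norm_nonneg _).trans (hD 0)
  set I := ∫ x, φ x
  set κ : ℝ := 1 / ((d + 1) * (D + 1)) with hκ
  have hκ0 : 0 < κ := by positivity
  refine ⟨κ * I / 8, by positivity, fun k n hk A e δ l hA hδ0 hl0 hl hU hδ => ?_⟩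
  have hk' : (0 : ℝ) < k := by exact_mod_cast hk
  have hcard : (Fintype.card (Fin d → Fin k) : ℝ) = (k : ℝ) ^ d := by simp
  have hball := signedSum_bump_mem_sobolevBall hp hk hφ' hφs hφ0 hφ1 hD0 hD
  have h1 := lt_of_isApproximating (ψ := bump (k := k) φ κ)
    (fun x i j h h' => eq_of_zoom_mem_interior (zoom_mem_of_bump_ne_zero hφs h)
      (zoom_mem_of_bump_ne_zero hφs h'))
    (I := κ / k * ((k : ℝ) ^ d)⁻¹ * I) (by positivity)
    (integralCube_signedSum_bump hk hφ.continuous hφs κ)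
    (fun ε => mem_sobolevSpace_of_mem_sobolevBall (hball ε)) hball A hA hδ0 hl0 hl
    (by rwa [hcard]) (by rwa [hcard])
  rw [hcard] at h1
  refine lt_of_eq_of_lt ?_ h1
  field_simp

theorem rate_asympLE (d : ℕ) (hd : 1 ≤ d) (p : ℝ≥0∞) (hp : 2 ≤ p)
    (q : ℝ) (hq : q = (min p 2).toReal) :
    AsympLE (fun n δ => ENNReal.ofReal (rate d q n δ)) (eProb d p) := by
  obtain ⟨κ, hκ, H⟩ := exists_error_lower_bound d (one_le_two.trans hp)
  have hq2 : q = 2 := by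
    rw [hq, min_eq_right hp]
    simp
  subst hq2
  -- These thresholds make `8 ≤ (N - n) * l ^ 2` hold in both cases of the minimum defining `l`: `N
  -- / 2 ≥ 16`, and `log δ⁻¹ / 8 > 8`.
  refine ⟨16, Real.exp (-64), ⟨Real.exp_pos _, by simp⟩, (κ / (8 * 2 ^ (d + 1)))⁻¹, by positivity,
    fun n hn δ hδ => ?_⟩
  simp only
  set C := κ / (8 * 2 ^ (d + 1)) with hC
  have hC0 : 0 < C := by positivity
  suffices h : ENNReal.ofReal (C * rate d 2 n δ) ≤ eProb d p n δ by
    calc ENNReal.ofReal (rate d 2 n δ)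
        = ENNReal.ofReal C⁻¹ * ENNReal.ofReal (C * rate d 2 n δ) := by
          rw [← ENNReal.ofReal_mul (by positivity), inv_mul_cancel_left₀ hC0.ne']
      _ ≤ _ := by gcongr
  refine le_iInf₂ fun e he => ENNReal.ofReal_le_ofReal ?_
  obtain ⟨-, A, hA⟩ := he
  have hn1 : 1 ≤ n := by omega
  have hn0 : (16 : ℝ) ≤ n := by exact_mod_cast hn
  have hd0 : (d : ℝ) ≠ 0 := by positivity
  set t := (n : ℝ) ^ (1 / (d : ℝ)) with ht
  have ht1 : 1 ≤ t := one_le_rpow_one_div d hn1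
  have htd : t ^ d = n := by
    rw [ht, ← Real.rpow_natCast, ← Real.rpow_mul (by positivity), one_div_mul_cancel hd0,
      Real.rpow_one]
  -- Doubling ensures `N = k ^ d ≥ 2 * n`, so at least half of the bumps stay unseen, while `k` is
  -- still of order `n^{1/d}`.
  set k := 2 * ⌈t⌉₊ with hk
  have hk0 : 0 < k := by
    have : 0 < ⌈t⌉₊ := Nat.ceil_pos.2 (by linarith)
    omega
  have hk1 : 2 * t ≤ k := by
    rw [hk]
    push_cast
    linarith [Nat.le_ceil t]
  have hk2 : (k : ℝ) ≤ 4 * t := by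
    rw [hk]
    push_cast
    linarith [Nat.ceil_lt_add_one (by linarith : 0 ≤ t)]
  have hk' : (0 : ℝ) < k := by exact_mod_cast hk0
  set N : ℝ := (k : ℝ) ^ d with hN
  have hN1 : 2 * (n : ℝ) ≤ N := by
    calc 2 * (n : ℝ) ≤ 2 ^ d * n := by
          gcongr
          exact le_self_pow₀ one_le_two (by omega)
      _ = (2 * t) ^ d := by rw [mul_pow, htd]
      _ ≤ N := by rw [hN]; gcongr
  have hN2 : N ≤ 4 ^ d * n := by
    calc N ≤ (4 * t) ^ d := by rw [hN]; gcongr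
      _ = _ := by rw [mul_pow, htd]
  have hN0 : 0 < N := by linarith
  have hlog : 64 < Real.log δ⁻¹ := by
    rw [Real.log_inv, lt_neg, Real.log_lt_iff_lt_exp hδ.1]
    exact hδ.2
  set Λ := Real.log δ⁻¹ with hΛ
  -- With this tilt `exp (-(2 * l ^ 2 * N)) ≥ √δ`, and `√δ < 1 / 4` leaves room for the factor `1 /
  -- 4` from Paley–Zygmund.
  set l := min 1 (√(Λ / (4 * N))) with hl
  have hl0 : 0 < l := lt_min one_pos (by positivity)
  have hl1 : l ≤ 1 := min_le_left _ _
  have hl2 : l ^ 2 = min 1 (Λ / (4 * N)) := by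
    rcases le_total 1 (√(Λ / (4 * N))) with h | h
    · rw [hl, min_eq_left h, min_eq_left, one_pow]
      exact Real.one_le_sqrt.1 h
    · rw [hl, min_eq_right h, Real.sq_sqrt (by positivity), min_eq_right]
      exact Real.sqrt_le_one.1 h
  have hU : 8 ≤ (N - n) * l ^ 2 := by
    have h1 : N / 2 ≤ N - n := by linarith
    have h2 : 8 ≤ N / 2 * l ^ 2 := by
      rw [hl2, mul_min_of_nonneg _ _ (by positivity), le_min_iff]
      constructor
      · linarith
      · have : N / 2 * (Λ / (4 * N)) = Λ / 8 := by
          field_simp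
          norm_num
        rw [this]
        linarith
    exact h2.trans (mul_le_mul_of_nonneg_right h1 (sq_nonneg l))
  have hδl : δ < Real.exp (-(2 * l ^ 2 * N)) / 4 := by
    have h1 : 2 * l ^ 2 * N ≤ Λ / 2 := by
      calc 2 * l ^ 2 * N ≤ 2 * (Λ / (4 * N)) * N := by
            gcongr
            rw [hl2]
            exact min_le_right _ _
        _ = Λ / 2 := by
            field_simp
            norm_num
    have h2 : Real.exp (-Λ) = δ := by
      rw [hΛ, Real.log_inv, neg_neg, Real.exp_log hδ.1]
    have h3 : Real.exp (-(Λ / 2)) ≤ Real.exp (-(2 * l ^ 2 * N)) := Real.exp_le_exp.2 (by linarith)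
    have h4 : δ = Real.exp (-(Λ / 2)) * Real.exp (-(Λ / 2)) := by
      rw [← Real.exp_add, ← h2]
      congr 1
      ring
    have h5 : Real.exp (-(Λ / 2)) < 1 / 4 := by
      rw [Real.exp_neg, inv_lt_comm₀ (Real.exp_pos _) (by norm_num)]
      have := Real.add_one_le_exp (Λ / 2)
      norm_num
      linarith
    have h6 := Real.exp_pos (-(Λ / 2))
    nlinarith
  have key := H k n hk0 A e δ l hA hδ.1.le hl0 hl1 hU hδl
  refine le_trans ?_ key.le
  have hlr : min 1 ((n : ℝ) ^ (-(1 - 1 / (2 : ℝ))) * √Λ) / 2 ^ (d + 1) ≤ l := by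
    rw [hl, le_min_iff]
    constructor
    · rw [div_le_one (by positivity)]
      exact (min_le_left _ _).trans (one_le_pow₀ one_le_two)
    · have h1 : (n : ℝ) ^ (-(1 - 1 / (2 : ℝ))) = (√n)⁻¹ := by
        rw [Real.rpow_neg (by positivity), Real.sqrt_eq_rpow]
        norm_num
      rw [h1]
      have h2 : √(Λ / (4 * N)) ≥ √(Λ / (4 * (4 ^ d * n))) := by
        apply Real.sqrt_le_sqrt
        gcongr
      refine le_trans ((div_le_div_of_nonneg_right (min_le_right _ _)
        (by positivity)).trans (le_of_eq ?_)) h2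
      have h3 : Λ / (4 * (4 ^ d * n)) = Λ / n / (2 ^ (d + 1)) ^ 2 := by
        rw [← pow_mul, mul_comm (d + 1), pow_mul]
        norm_num
        rw [pow_succ]
        field_simp
      rw [h3, Real.sqrt_div (by positivity), Real.sqrt_sq (by positivity),
        Real.sqrt_div (by positivity)]
      ring
  calc C * rate d 2 n δ
      = κ / (8 * t) * (min 1 ((n : ℝ) ^ (-(1 - 1 / (2 : ℝ))) * √Λ) / 2 ^ (d + 1)) := by
        rw [hC, rate, Real.rpow_neg (by positivity), ← ht, ← hΛ]
        field_simp
    _ ≤ κ / (8 * t) * l := by gcongr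
    _ = κ * (N / 2) * l / (4 * t * N) := by
        field_simp
        norm_num
    _ ≤ κ * (N - n) * l / (k * N) := by
        have h1 : N / 2 ≤ N - n := by linarith
        have h2 : 0 ≤ N - n := by linarith
        gcongr

end StratSampling

/-! ### Assembly of the upper and lower bounds -/

theorem mainTheorem6 (d : ℕ) (hd : 1 ≤ d) (p : ℝ≥0∞) (hp : (d : ℝ≥0∞) < p)
    (q : ℝ) (hq : q = (min p 2).toReal) :
    -- stratified sampling within the budget `n` is `(c · rate, δ)`-approximating
    StratSampling.ForSomeConstEventually (fun c n δ =>
      StratSampling.gridSize d n ^ d ≤ n ∧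
      ∀ (Ω : Type*) [MeasurableSpace Ω] (P : Measure Ω) [IsProbabilityMeasure P]
        (X : (Fin d → Fin (StratSampling.gridSize d n)) → Ω → (Fin d → ℝ)),
        StratSampling.IsStratifiedSample P X →
        StratSampling.IsApproximating P (StratSampling.stratified X)
          (StratSampling.sobolevBall d p) (c * StratSampling.rate d q n δ) δ) ∧
    -- the resulting upper bound for the minimal error
    StratSampling.AsympLE (StratSampling.eProb d p)
      (fun n δ => ENNReal.ofReal (StratSampling.rate d q n δ)) ∧
    -- the matching lower bound for `p ≥ 2`
    (2 ≤ p → StratSampling.AsympLE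
      (fun n δ => ENNReal.ofReal (StratSampling.rate d q n δ)) (StratSampling.eProb d p)) := by
  refine ⟨?_, StratSampling.eProb_asympLE d hd p hp q hq,
    fun hp2 => StratSampling.rate_asympLE d hd p hp2 q hq⟩
  obtain ⟨c, hc, H⟩ := StratSampling.exists_stratified_isApproximating d hd p hp q hq
  exact ⟨1, 1 / 2, by norm_num, c, hc, fun n hn δ hδ =>
    ⟨StratSampling.gridSize_pow_le hd n, fun Ω _ P _ X hX => H n hn δ hδ Ω P X hX⟩⟩
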